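/- Let $H$ be a finite-dimensional real inner product space with Clifford algebra $\mathrm{Cl}(H)$ (convention $x\cdot y+y\cdot x=-2\langle x,y\rangle$), and let $\Delta$ be a finite-dimensional complex vector space with a Hermitian inner product, equipped with a $\mathrm{Cl}(H)$-module structure by complex-linear maps such that $\langle x\cdot v,w\rangle=-\langle v,x\cdot w\rangle$ for all $x\in H$ and $v,w\in\Delta$. Let $a\in H$ be non-zero, and let $\Omega:\mathbb R\to a^\perp\subset H$ be a non-constant polynomial function. Consider the operator $$P=a\,\partial_t+i\,\Omega(t)$$ in the Hilbert space $L^2(\mathbb R,\Delta)$, with the Schwartz space $\mathcal S(\mathbb R,\Delta)$ as its domain, where $a$ and $\Omega(t)$ act by pointwise Clifford multiplication. Then $P$ is essentially self-adjoint (it is densely defined and symmetric, and its closure $\bar P$ is self-adjoint), and $\bar P$ has discrete spectrum: every point of the spectrum of $\bar P$ is an isolated point of the spectrum and an eigenvalue of finite multiplicity. Moreover, the resolvent set of $\bar P$ is non-empty, and the resolvent $(\bar P-z)^{-1}$ is a compact operator on $L^2(\mathbb R,\Delta)$ for every $z$ in it. -/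

import Mathlib

open MeasureTheory SchwartzMap
open scoped InnerProductSpace SchwartzMap ENNReal

noncomputable section

/-! ### Clifford modules -/

/-- The quadratic form `x ↦ -‖x‖²`. Its Clifford algebra is `Cl(H)`, with `x * x = -‖x‖²`
for `x ∈ H`. -/
def negNormSqForm (H : Type*) [NormedAddCommGroup H] [InnerProductSpace ℝ H] :
    QuadraticForm ℝ H :=
  -LinearMap.BilinMap.toQuadraticMap (innerₗ H)

theorem negNormSqForm_apply {H : Type*} [NormedAddCommGroup H] [InnerProductSpace ℝ H] (x : H) :
    negNormSqForm H x = -‖x‖ ^ 2 := by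
  simp [negNormSqForm]

/-- The Clifford algebra `Cl(H)` of a real inner product space `H`, in the convention
`x * y + y * x = -2 ⟪x, y⟫`. -/
abbrev CliffordAlg (H : Type*) [NormedAddCommGroup H] [InnerProductSpace ℝ H] : Type _ :=
  CliffordAlgebra (negNormSqForm H)

section Dirac

variable {H : Type*} [NormedAddCommGroup H] [InnerProductSpace ℝ H]
variable {Δ : Type*} [NormedAddCommGroup Δ] [InnerProductSpace ℂ Δ]

/-- A `Cl(H)`-module structure on the complex vector space `Δ`, given as an algebra homomorphism
`ρ : Cl(H) → End_ℂ(Δ)`, is skew if `⟪x · v, w⟫ = -⟪v, x · w⟫` for all `x ∈ H ⊆ Cl(H)`. -/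
def IsSkewCliffordModule (ρ : CliffordAlg H →ₐ[ℝ] Module.End ℂ Δ) : Prop :=
  ∀ (x : H) (v w : Δ),
    ⟪ρ (CliffordAlgebra.ι (negNormSqForm H) x) v, w⟫_ℂ =
      -⟪v, ρ (CliffordAlgebra.ι (negNormSqForm H) x) w⟫_ℂ

/-- A polynomial function `ℝ → H`. -/
def IsPolynomialFun (Ω : ℝ → H) : Prop :=
  ∃ (n : ℕ) (c : ℕ → H), ∀ t : ℝ, Ω t = ∑ k ∈ Finset.range n, t ^ k • c k

variable [FiniteDimensional ℂ Δ]

/-- Clifford multiplication by `x ∈ H` as an operator on `Δ`. -/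
def cliffordMul (ρ : CliffordAlg H →ₐ[ℝ] Module.End ℂ Δ) : H →ₗ[ℝ] (Δ →L[ℂ] Δ) where
  toFun x := LinearMap.toContinuousLinearMap (ρ (CliffordAlgebra.ι (negNormSqForm H) x))
  map_add' x y := by ext v; simp
  map_smul' r x := by ext v; simp

@[simp]
theorem cliffordMul_apply (ρ : CliffordAlg H →ₐ[ℝ] Module.End ℂ Δ) (x : H) (v : Δ) :
    cliffordMul ρ x v = ρ (CliffordAlgebra.ι (negNormSqForm H) x) v := rfl

theorem hasTemperateGrowth_cliffordMul (ρ : CliffordAlg H →ₐ[ℝ] Module.End ℂ Δ) {Ω : ℝ → H}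
    (hΩ : IsPolynomialFun Ω) : (fun t : ℝ => cliffordMul ρ (Ω t)).HasTemperateGrowth := by
  obtain ⟨n, c, hc⟩ := hΩ
  have h : (fun t : ℝ => cliffordMul ρ (Ω t)) =
      fun t : ℝ => ∑ k ∈ Finset.range n, t ^ k • cliffordMul ρ (c k) := by
    funext t
    simp [hc]
  rw [h]
  refine Function.HasTemperateGrowth.sum fun k _ => ?_
  exact (Function.HasTemperateGrowth.id'.pow k).smul (Function.HasTemperateGrowth.const _)

/-- The differential operator `a ∂_t + i Ω(t)` on the Schwartz space `𝓢(ℝ, Δ)`. -/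
def diracSchwartz (ρ : CliffordAlg H →ₐ[ℝ] Module.End ℂ Δ) (a : H) {Ω : ℝ → H}
    (hΩ : IsPolynomialFun Ω) : 𝓢(ℝ, Δ) →L[ℂ] 𝓢(ℝ, Δ) :=
  (postcompCLM (𝕜 := ℂ) (cliffordMul ρ a)).comp (derivCLM ℂ Δ) +
    Complex.I • bilinLeftCLM (ContinuousLinearMap.apply ℂ Δ)
      (hasTemperateGrowth_cliffordMul ρ hΩ)

theorem diracSchwartz_apply (ρ : CliffordAlg H →ₐ[ℝ] Module.End ℂ Δ) (a : H) {Ω : ℝ → H}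
    (hΩ : IsPolynomialFun Ω) (φ : 𝓢(ℝ, Δ)) (t : ℝ) :
    diracSchwartz ρ a hΩ φ t =
      ρ (CliffordAlgebra.ι (negNormSqForm H) a) (deriv φ t) +
        Complex.I • ρ (CliffordAlgebra.ι (negNormSqForm H) (Ω t)) (φ t) := by
  simp [diracSchwartz]

/-- The inclusion `𝓢(ℝ, Δ) → L²(ℝ, Δ)`. -/
def schwartzToL2 (Δ : Type*) [NormedAddCommGroup Δ] [InnerProductSpace ℂ Δ] :
    𝓢(ℝ, Δ) →ₗ[ℂ] Lp Δ 2 (volume : Measure ℝ) :=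
  (toLpCLM ℂ Δ 2 (volume : Measure ℝ)).toLinearMap

theorem schwartzToL2_injective : Function.Injective (schwartzToL2 Δ) :=
  injective_toLp 2 (volume : Measure ℝ)

/-- The operator `P = a ∂_t + i Ω(t)` as an unbounded operator in `L²(ℝ, Δ)` with domain
`𝓢(ℝ, Δ)`. -/
def diracOp (ρ : CliffordAlg H →ₐ[ℝ] Module.End ℂ Δ) (a : H) {Ω : ℝ → H}
    (hΩ : IsPolynomialFun Ω) :
    Lp Δ 2 (volume : Measure ℝ) →ₗ.[ℂ] Lp Δ 2 (volume : Measure ℝ) where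
  domain := LinearMap.range (schwartzToL2 Δ)
  toFun := (schwartzToL2 Δ).comp ((diracSchwartz ρ a hΩ).toLinearMap.comp
    (LinearEquiv.ofInjective (schwartzToL2 Δ) schwartzToL2_injective).symm.toLinearMap)

theorem diracOp_apply (ρ : CliffordAlg H →ₐ[ℝ] Module.End ℂ Δ) (a : H) {Ω : ℝ → H}
    (hΩ : IsPolynomialFun Ω) (φ : 𝓢(ℝ, Δ)) :
    diracOp ρ a hΩ ⟨schwartzToL2 Δ φ, LinearMap.mem_range_self _ φ⟩ =
      schwartzToL2 Δ (diracSchwartz ρ a hΩ φ) := by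
  have h : (LinearEquiv.ofInjective (schwartzToL2 Δ) schwartzToL2_injective).symm
      ⟨schwartzToL2 Δ φ, LinearMap.mem_range_self _ φ⟩ = φ := by
    rw [LinearEquiv.symm_apply_eq]
    rfl
  change schwartzToL2 Δ (diracSchwartz ρ a hΩ _) = _
  exact congrArg (fun f => schwartzToL2 Δ (diracSchwartz ρ a hΩ f)) h

end Dirac

/-! ### Unbounded operators in a complex Hilbert space -/

section Unbounded

variable {E : Type*} [NormedAddCommGroup E] [InnerProductSpace ℂ E]

/-- Densely defined, symmetric, and with self-adjoint closure. -/
def IsEssentiallySelfAdjoint [CompleteSpace E] (T : E →ₗ.[ℂ] E) : Prop :=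
  Dense (T.domain : Set E) ∧ T.IsFormalAdjoint T ∧ T.IsClosable ∧ IsSelfAdjoint T.closure

/-- The bounded operator `R` is the inverse of `T - z : dom T → E`. -/
def IsResolventAt (T : E →ₗ.[ℂ] E) (z : ℂ) (R : E →L[ℂ] E) : Prop :=
  (∀ y : E, ∃ h : R y ∈ T.domain, T ⟨R y, h⟩ - z • R y = y) ∧
    ∀ x : T.domain, R (T x - z • (x : E)) = x

/-- The set of `z` for which `T - z : dom T → E` is bijective with bounded inverse. -/
def unboundedResolventSet (T : E →ₗ.[ℂ] E) : Set ℂ :=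
  {z | ∃ R : E →L[ℂ] E, IsResolventAt T z R}

/-- The spectrum of an unbounded operator. -/
def unboundedSpectrum (T : E →ₗ.[ℂ] E) : Set ℂ :=
  (unboundedResolventSet T)ᶜ

/-- The kernel of `T - z`, as a subspace of the domain of `T`. -/
def unboundedEigenspace (T : E →ₗ.[ℂ] E) (z : ℂ) : Submodule ℂ T.domain :=
  LinearMap.ker (T.toFun - z • T.domain.subtype)

/-- A self-adjoint operator has discrete spectrum if every point of its spectrum is an isolated
point of the spectrum and an eigenvalue of finite multiplicity (that is, if its essential spectrum
is empty). -/
def HasDiscreteSpectrum (T : E →ₗ.[ℂ] E) : Prop :=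
  ∀ z ∈ unboundedSpectrum T,
    ¬ AccPt z (Filter.principal (unboundedSpectrum T)) ∧
      unboundedEigenspace T z ≠ ⊥ ∧ FiniteDimensional ℂ (unboundedEigenspace T z)

/-- The resolvent set is non-empty, and `(T - z)⁻¹` is compact for all `z` in it. -/
def HasCompactResolvent (T : E →ₗ.[ℂ] E) : Prop :=
  (unboundedResolventSet T).Nonempty ∧
    ∀ (z : ℂ) (R : E →L[ℂ] E), IsResolventAt T z R → IsCompactOperator R

end Unbounded

end

/-! `P` is symmetric because `a` and `Ω` act by skew maps: `⟪Pφ, ψ⟫ - ⟪φ, Pψ⟫` is the integral of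
the derivative of `⟪a φ, ψ⟫`.

Self-adjointness of the closure reduces to density of the range of `P - z` for non-real `z`. A
vector `y` orthogonal to this range is a weak, hence classical, solution of `a u' + i Ω u = z̄ u`.
Then `⟪a u, u⟫` has derivative `(z - z̄) ‖u‖²`. Both are integrable since `u` is in `L²`, so `∫ ‖u‖²
= 0` (`IsSkewCliffordModule.eq_zero_of_inner_diracSchwartz_eq_zero`). With the bound `|Im z| ‖x‖ ≤
‖(T - z) x‖` for symmetric `T`, this gives bounded resolvents off the real axis.

Compactness rests on an energy estimate (`IsSkewCliffordModule.energy_le`). Since `a` anticommutes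
with `Ω(t)`, the cross term in `‖Pφ‖²` is a total derivative up to a term in `Ω'`, so `‖Pφ‖² ≥ ∫
‖a‖² ‖φ'‖² + (‖Ω‖² - ‖a‖ ‖Ω'‖) ‖φ‖²`. The potential tends to infinity because `Ω` is a non-constant
polynomial. Hence the graph norm controls `φ'` and makes the tails of `φ` uniformly small. Step
functions on a fixed partition then approximate `φ` (`exists_step_approx`), and the resolvent is a
norm limit of finite-rank operators. Discreteness of the spectrum follows from the spectral theory
of compact operators. -/

noncomputable section

/-! ### Symmetric operators: closure, non-real resolvents, self-adjointness. -/

namespace LinearPMap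

variable {E : Type*} [NormedAddCommGroup E] [InnerProductSpace ℂ E] {T : E →ₗ.[ℂ] E}

/-- The graph of the closure is the closure of the graph, so closed conditions extend. This carries
both symmetry and the approximation estimate from Schwartz functions to the closure. -/
theorem IsClosable.closure_induction (hT : T.IsClosable) {p : E × E → Prop}
    (hp : _root_.IsClosed {q | p q}) (h : ∀ x : T.domain, p (x, T x)) (x : T.closure.domain) :
    p (x, T.closure x) := by
  have hx : ((x : E), T.closure x) ∈ T.closure.graph := T.closure.mem_graph x
  rw [← hT.graph_closure_eq_closure_graph] at hx
  refine closure_minimal (t := {q | p q}) ?_ hp hx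
  rintro ⟨u, v⟩ huv
  obtain ⟨y, hy1, hy2⟩ := (T.mem_graph_iff).1 huv
  simp only at hy1 hy2
  subst hy1 hy2
  exact h y

theorem IsClosed.exists_of_tendsto (hT : T.IsClosed) {ι : Type*} {l : Filter ι} [l.NeBot]
    {u : ι → T.domain} {x y : E} (hx : Filter.Tendsto (fun n => (u n : E)) l (nhds x))
    (hy : Filter.Tendsto (fun n => T (u n)) l (nhds y)) : ∃ h : x ∈ T.domain, T ⟨x, h⟩ = y := by
  have h : (x, y) ∈ T.graph :=
    _root_.IsClosed.mem_of_tendsto hT (hx.prodMk_nhds hy)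
      (Filter.Eventually.of_forall fun n => T.mem_graph (u n))
  obtain ⟨z, hz1, hz2⟩ := (T.mem_graph_iff).1 h
  simp only at hz1 hz2
  subst hz1
  exact ⟨z.2, hz2⟩

theorem IsFormalAdjoint.isClosable [CompleteSpace E] (hd : Dense (T.domain : Set E))
    (hT : T.IsFormalAdjoint T) : T.IsClosable :=
  (adjoint_isClosed hd).isClosable.leIsClosable (IsFormalAdjoint.le_adjoint hd hT)

theorem IsFormalAdjoint.closure (hc : T.IsClosable) (hT : T.IsFormalAdjoint T) :
    T.closure.IsFormalAdjoint T.closure := by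
  have h1 : ∀ (x : T.closure.domain) (y : T.domain), ⟪T.closure x, y⟫_ℂ = ⟪(x : E), T y⟫_ℂ := by
    intro x y
    refine hc.closure_induction (p := fun q => ⟪q.2, (y : E)⟫_ℂ = ⟪q.1, T y⟫_ℂ)
      (isClosed_eq (by fun_prop) (by fun_prop)) (fun x => hT x y) x
  intro x y
  exact hc.closure_induction (p := fun q => ⟪T.closure x, q.1⟫_ℂ = ⟪(x : E), q.2⟫_ℂ)
      (isClosed_eq (by fun_prop) (by fun_prop)) (fun y => h1 x y) y

theorem IsFormalAdjoint.im_inner_self (hT : T.IsFormalAdjoint T) (x : T.domain) :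
    (⟪(x : E), T x⟫_ℂ).im = 0 := by
  have h := hT x x
  rw [← inner_conj_symm] at h
  exact Complex.conj_eq_iff_im.1 h

/-- `⟪x, T x⟫` is real, so `⟪x, (T - z) x⟫` has imaginary part `-Im z ‖x‖²`; then Cauchy–Schwarz. -/
theorem IsFormalAdjoint.abs_im_mul_norm_le (hT : T.IsFormalAdjoint T) (z : ℂ) (x : T.domain) :
    |z.im| * ‖(x : E)‖ ≤ ‖T x - z • (x : E)‖ := by
  have h : (⟪(x : E), T x - z • (x : E)⟫_ℂ).im = -(z.im * ‖(x : E)‖ ^ 2) := by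
    rw [inner_sub_right, inner_smul_right, Complex.sub_im, hT.im_inner_self,
      inner_self_eq_norm_sq_to_K]
    simp [← Complex.ofReal_pow]
  have h2 : |z.im| * ‖(x : E)‖ ^ 2 ≤ ‖(x : E)‖ * ‖T x - z • (x : E)‖ := by
    calc |z.im| * ‖(x : E)‖ ^ 2 = |(⟪(x : E), T x - z • (x : E)⟫_ℂ).im| := by
          rw [h, abs_neg, abs_mul, abs_of_nonneg (sq_nonneg ‖(x : E)‖)]
      _ ≤ _ := (Complex.abs_im_le_norm _).trans (norm_inner_le_norm _ _)
  rcases (norm_nonneg (x : E)).eq_or_lt with h0 | h0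
  · rw [← h0, mul_zero]; exact norm_nonneg _
  · nlinarith

/-- The lower bound on `T - z` gives injectivity and the norm of the inverse. It also makes
preimages of a convergent sequence Cauchy, so closedness of `T` upgrades dense range to
surjectivity. -/
theorem IsFormalAdjoint.exists_isResolventAt [CompleteSpace E] (hT : T.IsFormalAdjoint T)
    (hcl : T.IsClosed) {z : ℂ} (hz : z.im ≠ 0)
    (hd : Dense (Set.range fun x : T.domain => T x - z • (x : E))) :
    ∃ R : E →L[ℂ] E, IsResolventAt T z R := by
  set D : T.domain →ₗ[ℂ] E := T.toFun - z • T.domain.subtype with hD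
  have hDa : ∀ x : T.domain, D x = T x - z • (x : E) := fun x => rfl
  have hpos : 0 < |z.im| := abs_pos.2 hz
  have hb : ∀ x : T.domain, |z.im| * ‖(x : E)‖ ≤ ‖D x‖ := hT.abs_im_mul_norm_le z
  have hinj : Function.Injective D := by
    rw [← LinearMap.ker_eq_bot, LinearMap.ker_eq_bot']
    intro x hx
    have := hb x
    rw [hx, norm_zero] at this
    have h0 : ‖(x : E)‖ ≤ 0 := by nlinarith
    exact Subtype.ext (norm_le_zero_iff.1 h0)
  have hsurj : Function.Surjective D := by
    intro y
    obtain ⟨u, hu, huy⟩ := mem_closure_iff_seq_limit.1 (hd y)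
    choose v hv using hu
    have hcau : CauchySeq fun n => (v n : E) := by
      rw [Metric.cauchySeq_iff']
      intro ε hε
      obtain ⟨N, hN⟩ := Metric.cauchySeq_iff'.1 huy.cauchySeq (|z.im| * ε) (by positivity)
      refine ⟨N, fun n hn => ?_⟩
      have h1 := hb (v n - v N)
      rw [show D (v n - v N) = D (v n) - D (v N) from LinearMap.map_sub D _ _, hDa, hDa] at h1
      have h2 := hN n hn
      rw [dist_eq_norm, ← hv, ← hv] at h2
      rw [dist_eq_norm]
      push_cast at h1
      have h3 := h1.trans_lt h2
      exact lt_of_mul_lt_mul_left h3 hpos.le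
    obtain ⟨x, hx⟩ := cauchySeq_tendsto_of_complete hcau
    have hTx : Filter.Tendsto (fun n => T (v n)) Filter.atTop (nhds (y + z • x)) := by
      refine (huy.add (hx.const_smul z)).congr fun n => ?_
      rw [← hv]; simp
    obtain ⟨h, h2⟩ := hcl.exists_of_tendsto hx hTx
    exact ⟨⟨x, h⟩, by rw [hDa, h2]; simp⟩
  let e := LinearEquiv.ofBijective D ⟨hinj, hsurj⟩
  have he : ∀ y, D (e.symm y) = y := fun y => e.apply_symm_apply y
  refine ⟨LinearMap.mkContinuous (T.domain.subtype ∘ₗ e.symm.toLinearMap) |z.im|⁻¹ ?_, ?_, ?_⟩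
  · intro y
    have := hb (e.symm y)
    rw [he] at this
    rw [inv_mul_eq_div, le_div_iff₀' hpos]
    exact this
  · intro y
    exact ⟨(e.symm y).2, he y⟩
  · intro x
    have : e.symm (D x) = x := e.symm_apply_apply x
    exact congrArg Subtype.val this

/-- For `y` in the domain of the adjoint, subtracting the solution `R w` of `(T - z) x = (T* - z) y`
leaves an element of the kernel of `T* - z`. That kernel is orthogonal to the range of `T - z̄`,
which is everything. -/
theorem IsFormalAdjoint.isSelfAdjoint [CompleteSpace E] (hT : T.IsFormalAdjoint T)
    (hd : Dense (T.domain : Set E)) {z : ℂ} {R R' : E →L[ℂ] E}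
    (hR : IsResolventAt T z R) (hR' : IsResolventAt T (starRingEnd ℂ z) R') :
    IsSelfAdjoint T := by
  rw [isSelfAdjoint_def]
  have hle : T ≤ T.adjoint := IsFormalAdjoint.le_adjoint hd hT
  refine (eq_of_le_of_domain_eq hle (le_antisymm hle.1 fun y hy => ?_)).symm
  set w : E := T.adjoint ⟨y, hy⟩ - z • y with hw
  obtain ⟨h1, h2⟩ := hR.1 w
  have hadj := adjoint_isFormalAdjoint hd
  suffices y = R w by rw [this]; exact h1
  rw [← sub_eq_zero, ← inner_self_eq_zero (𝕜 := ℂ)]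
  have key : ∀ x : T.domain, ⟪y - R w, T x - (starRingEnd ℂ z) • (x : E)⟫_ℂ = 0 := by
    intro x
    have e1 := hadj ⟨y, hy⟩ x
    have e2 := hT ⟨R w, h1⟩ x
    simp only at e1 e2
    have e3 : T.adjoint ⟨y, hy⟩ - T ⟨R w, h1⟩ = z • (y - R w) := by
      rw [← sub_eq_zero, smul_sub]
      rw [sub_sub_sub_comm, h2, ← hw, sub_self]
    rw [inner_sub_right, inner_sub_left, ← e1, ← e2, ← inner_sub_left, e3, inner_smul_left,
      inner_smul_right, sub_self]
  -- `y - R w` itself lies in the range of `T - z̄`, so it is orthogonal to itself.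
  obtain ⟨h3, h4⟩ := hR'.1 (y - R w)
  have := key ⟨_, h3⟩
  rwa [h4] at this

end LinearPMap

/-! ### Compact resolvents and discrete spectrum. -/

section

variable {E : Type*} [NormedAddCommGroup E] [InnerProductSpace ℂ E]

theorem Submodule.norm_sub_starProjection_le (V : Submodule ℂ E) [V.HasOrthogonalProjection]
    (x : E) {v : E} (hv : v ∈ V) : ‖x - V.starProjection x‖ ≤ ‖x - v‖ := by
  rw [V.starProjection_minimal]
  exact ciInf_le ⟨0, by rintro _ ⟨w, rfl⟩; exact norm_nonneg _⟩ (⟨v, hv⟩ : V)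

/-- `R` is a norm limit of the finite-rank operators `V.starProjection ∘L R`, and compact operators
form a closed set. -/
theorem isCompactOperator_of_approx [CompleteSpace E] {R : E →L[ℂ] E}
    (h : ∀ ε : ℝ, 0 < ε → ∃ (V : Submodule ℂ E) (_ : FiniteDimensional ℂ V),
      ∀ y, ‖R y - V.starProjection (R y)‖ ≤ ε * ‖y‖) : IsCompactOperator R := by
  have hcl := isClosed_setOfPred_isCompactOperator (𝕜₁ := ℂ) (𝕜₂ := ℂ) (σ₁₂ := RingHom.id ℂ)
    (M₁ := E) (M₂ := E)
  have : R ∈ {f : E →L[ℂ] E | IsCompactOperator f} := by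
    rw [← hcl.closure_eq, Metric.mem_closure_iff]
    intro ε hε
    obtain ⟨V, hV, hy⟩ := h (ε / 2) (by positivity)
    refine ⟨V.starProjection ∘L R, ?_, ?_⟩
    · have : ProperSpace V := FiniteDimensional.proper ℂ V
      have hc : IsCompactOperator (V.subtypeL : V → E) :=
        isCompactOperator_of_locallyCompactSpace_rng _
      exact hc.comp_clm (V.orthogonalProjectionOnto ∘L R)
    · rw [dist_eq_norm]
      exact (ContinuousLinearMap.opNorm_le_bound _ (by positivity) fun y => hy y).trans_lt
        (half_lt_self hε)
  exact this

/-- A resolvent is compact if the unit ball of the graph norm is approximated by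
finite-dimensional subspaces. -/
theorem IsResolventAt.isCompactOperator [CompleteSpace E] {T : E →ₗ.[ℂ] E} {z : ℂ} {R : E →L[ℂ] E}
    (hR : IsResolventAt T z R)
    (h : ∀ ε : ℝ, 0 < ε → ∃ (V : Submodule ℂ E) (_ : FiniteDimensional ℂ V),
      ∀ x : T.domain, ‖(x : E) - V.starProjection x‖ ≤ ε * (‖(x : E)‖ + ‖T x‖)) :
    IsCompactOperator R := by
  refine isCompactOperator_of_approx fun ε hε => ?_
  -- Bounds the graph norm of `R y` by `C * ‖y‖`, using `T (R y) = y + z • R y`.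
  set C : ℝ := (1 + ‖z‖) * ‖R‖ + 1 with hC
  have hC0 : 0 < C := by positivity
  obtain ⟨V, hV, hx⟩ := h (ε / C) (by positivity)
  refine ⟨V, hV, fun y => ?_⟩
  obtain ⟨h1, h2⟩ := hR.1 y
  refine (hx ⟨R y, h1⟩).trans ?_
  have h3 : T ⟨R y, h1⟩ = y + z • R y := by rw [← sub_eq_iff_eq_add, h2]
  have h4 : ‖R y‖ + ‖T ⟨R y, h1⟩‖ ≤ C * ‖y‖ := by
    rw [h3]
    calc ‖R y‖ + ‖y + z • R y‖ ≤ ‖R y‖ + (‖y‖ + ‖z‖ * ‖R y‖) := by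
          gcongr; exact (norm_add_le _ _).trans (by rw [norm_smul])
      _ = (1 + ‖z‖) * ‖R y‖ + ‖y‖ := by ring
      _ ≤ (1 + ‖z‖) * (‖R‖ * ‖y‖) + ‖y‖ := by gcongr; exact R.le_opNorm y
      _ = C * ‖y‖ := by rw [hC]; ring
  calc _ ≤ ε / C * (C * ‖y‖) := by gcongr
    _ = ε * ‖y‖ := by field_simp

theorem IsResolventAt.mem_domain_of_eigen {T : E →ₗ.[ℂ] E} {z₀ : ℂ} {R : E →L[ℂ] E}
    (hR : IsResolventAt T z₀ R) {μ : ℂ} (hμ : μ ≠ 0) {x : E} (hx : R x = μ • x) :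
    ∃ h : x ∈ T.domain, T ⟨x, h⟩ = (z₀ + μ⁻¹) • x := by
  obtain ⟨h1, h2⟩ := hR.1 (μ⁻¹ • x)
  have h3 : R (μ⁻¹ • x) = x := by rw [map_smul, hx, inv_smul_smul₀ hμ]
  rw [h3] at h1
  refine ⟨h1, ?_⟩
  simp only [h3] at h2
  rw [sub_eq_iff_eq_add.1 h2, add_smul, add_comm]

theorem IsResolventAt.apply_eigen {T : E →ₗ.[ℂ] E} {z₀ : ℂ} {R : E →L[ℂ] E}
    (hR : IsResolventAt T z₀ R) {z : ℂ} (hz : z ≠ z₀) {x : T.domain} (hx : T x = z • (x : E)) :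
    R x = (z - z₀)⁻¹ • (x : E) := by
  have h := hR.2 x
  rw [hx, ← sub_smul, map_smul] at h
  rw [eq_inv_smul_iff₀ (sub_ne_zero.2 hz), h]

/-- On the domain, `T - z = (z - z₀) ((z - z₀)⁻¹ - R) (T - z₀)`; inverting each factor gives the
resolvent at `z`. -/
theorem IsResolventAt.of_mem_resolventSet {T : E →ₗ.[ℂ] E} {z₀ : ℂ} {R : E →L[ℂ] E}
    (hR : IsResolventAt T z₀ R) {z : ℂ} (hz : z ≠ z₀) (h : (z - z₀)⁻¹ ∈ resolventSet ℂ R) :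
    z ∈ unboundedResolventSet T := by
  have hz' := sub_ne_zero.2 hz
  obtain ⟨u, hu⟩ := spectrum.mem_resolventSet_iff.1 h
  set Q : E →L[ℂ] E := ↑(u⁻¹) with hQ
  have hu' : ∀ x, (u : E →L[ℂ] E) x = (z - z₀)⁻¹ • x - R x := fun x => by
    rw [hu]; simp [Algebra.algebraMap_eq_smul_one]
  have e1 : ∀ y, (z - z₀)⁻¹ • Q y - R (Q y) = y := fun y => by
    rw [← hu', ← mul_apply_eq_comp, hQ, u.mul_inv]; rfl
  have e2 : ∀ y, Q ((z - z₀)⁻¹ • y - R y) = y := fun y => by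
    rw [← hu', ← mul_apply_eq_comp, hQ, u.inv_mul]; rfl
  refine ⟨(z - z₀)⁻¹ • (R ∘L Q), fun y => ?_, fun x => ?_⟩
  · obtain ⟨h1, h2⟩ := hR.1 ((z - z₀)⁻¹ • Q y)
    have h3 : ((z - z₀)⁻¹ • (R ∘L Q)) y = R ((z - z₀)⁻¹ • Q y) := by simp
    simp only [h3]
    refine ⟨h1, ?_⟩
    rw [sub_eq_iff_eq_add.1 h2]
    rw [add_sub_assoc, ← sub_smul, ← neg_sub z z₀, neg_smul, ← sub_eq_add_neg, map_smul,
      smul_inv_smul₀ hz', e1]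
  · have h3 := hR.2 x
    have h4 : T x - z • (x : E) = (z - z₀) •
        ((z - z₀)⁻¹ • (T x - z₀ • (x : E)) - R (T x - z₀ • (x : E))) := by
      rw [h3, smul_sub, smul_inv_smul₀ hz', sub_smul]
      abel
    rw [h4]
    change (z - z₀)⁻¹ • R (Q _) = _
    rw [map_smul, map_smul, e2, inv_smul_smul₀ hz', h3]

theorem LinearPMap.IsFormalAdjoint.inner_eq_zero_of_eigen {T : E →ₗ.[ℂ] E}
    (hT : T.IsFormalAdjoint T) {z w : ℂ} (hzw : z ≠ w) {x y : T.domain}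
    (hx : T x = z • (x : E)) (hy : T y = w • (y : E)) : ⟪(x : E), (y : E)⟫_ℂ = 0 := by
  by_cases hx0 : (x : E) = 0
  · rw [hx0, inner_zero_left]
  have hz : starRingEnd ℂ z = z := by
    rw [Complex.conj_eq_iff_im]
    have h := hT.abs_im_mul_norm_le z x
    rw [hx, sub_self, norm_zero] at h
    have h0 : 0 < ‖(x : E)‖ := norm_pos_iff.2 hx0
    have : |z.im| ≤ 0 := by nlinarith [abs_nonneg z.im]
    simpa using this
  have h := hT x y
  rw [hx, hy, inner_smul_left, inner_smul_right, hz] at h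
  by_contra h0
  exact hzw (mul_right_cancel₀ h0 h)

/-- The map `z ↦ (z - z₀)⁻¹` matches eigenvectors of `T` with those of `R`. By the Fredholm
alternative every spectral point is then an eigenvalue, of finite multiplicity since `(z - z₀)⁻¹ ≠
0`. -/
theorem HasDiscreteSpectrum.of_isCompactOperator [CompleteSpace E] {T : E →ₗ.[ℂ] E}
    (hT : T.IsFormalAdjoint T) {z₀ : ℂ} {R : E →L[ℂ] E} (hR : IsResolventAt T z₀ R)
    (hRc : IsCompactOperator R) : HasDiscreteSpectrum T := by
  have hne : ∀ z ∈ unboundedSpectrum T, z ≠ z₀ := by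
    rintro z hz rfl
    exact hz ⟨R, hR⟩
  have heig : ∀ z ∈ unboundedSpectrum T, ∃ x : T.domain, (x : E) ≠ 0 ∧ T x = z • (x : E) := by
    intro z hz
    have hz' := sub_ne_zero.2 (hne z hz)
    rcases hRc.hasEigenvalue_or_mem_resolventSet (inv_ne_zero hz') with h | h
    · obtain ⟨x, hx⟩ := h.exists_hasEigenvector
      obtain ⟨h1, h2⟩ := hR.mem_domain_of_eigen (inv_ne_zero hz') hx.apply_eq_smul
      refine ⟨⟨x, h1⟩, hx.2, ?_⟩
      rw [h2]; simp
    · exact absurd (hR.of_mem_resolventSet (hne z hz) h) hz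
  -- Infinitely many spectral points in the ball would give orthonormal eigenvectors whose images
  -- under `R` are orthogonal of norm at least `M⁻¹`, so without a Cauchy subsequence.
  have hfin : ∀ M : ℝ, 0 < M → (unboundedSpectrum T ∩ Metric.ball z₀ M).Finite := by
    intro M hM
    by_contra hinf
    set f := Set.Infinite.natEmbedding _ hinf with hf
    have hx : ∀ n, ∃ x : T.domain, ‖(x : E)‖ = 1 ∧ T x = (f n : ℂ) • (x : E) := by
      intro n
      obtain ⟨x, hx0, hx⟩ := heig _ (f n).2.1
      refine ⟨((‖(x : E)‖ : ℂ)⁻¹) • x, ?_, ?_⟩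
      · have : ‖(x : E)‖ ≠ 0 := norm_ne_zero_iff.2 hx0
        simp [norm_smul, this]
      · rw [LinearPMap.map_smul, hx, smul_comm]; rfl
    choose e he1 he2 using hx
    obtain ⟨K, hK, hK'⟩ := hRc.image_closedBall_subset_compact (𝕜₁ := ℂ) 1
    obtain ⟨y, -, ψ, hψ, hψy⟩ := hK.tendsto_subseq
      (fun n => hK' ⟨(e n : E), by simp [he1], rfl⟩)
    have hcau := hψy.cauchySeq
    rw [Metric.cauchySeq_iff'] at hcau
    obtain ⟨N, hN⟩ := hcau (M⁻¹) (by positivity)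
    have h1 := hN (N + 1) (Nat.le_succ N)
    simp only [Function.comp_apply] at h1
    change dist (R _) (R _) < _ at h1
    rw [hR.apply_eigen (hne _ (f _).2.1) (he2 _), hR.apply_eigen (hne _ (f _).2.1) (he2 _),
      dist_eq_norm] at h1
    have horth : ⟪(e (ψ (N + 1)) : E), (e (ψ N) : E)⟫_ℂ = 0 := by
      refine hT.inner_eq_zero_of_eigen (fun h => ?_) (he2 _) (he2 _)
      have := hψ.injective (f.injective (Subtype.ext h))
      omega
    set p := ((f (ψ (N + 1)) : ℂ) - z₀)⁻¹
    set q := ((f (ψ N) : ℂ) - z₀)⁻¹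
    have h2 := norm_sub_sq (𝕜 := ℂ) (p • (e (ψ (N + 1)) : E)) (q • (e (ψ N) : E))
    rw [inner_smul_left, inner_smul_right, horth] at h2
    simp only [mul_zero, map_zero, sub_zero, norm_smul, he1, mul_one] at h2
    have hp : M⁻¹ ≤ ‖p‖ := by
      rw [norm_inv]
      have h3 := (f (ψ (N + 1))).2.2
      rw [Metric.mem_ball, dist_eq_norm] at h3
      exact inv_anti₀ (norm_pos_iff.2 (sub_ne_zero.2 (hne _ (f _).2.1))) h3.le
    have : 0 < M⁻¹ := by positivity
    nlinarith [norm_nonneg (p • (e (ψ (N + 1)) : E) - q • (e (ψ N) : E)), sq_nonneg ‖q‖]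
  intro z hz
  refine ⟨fun hacc => ?_, ?_, ?_⟩
  · rw [accPt_iff_frequently] at hacc
    set F := unboundedSpectrum T ∩ Metric.ball z₀ (dist z z₀ + 1) with hF
    have hFf : F.Finite := hfin _ (by positivity)
    have hcl : IsClosed (F \ {z}) := (hFf.subset Set.sdiff_subset).isClosed
    have h1 : ∀ᶠ y in nhds z, y ∉ F \ {z} := hcl.isOpen_compl.mem_nhds (by simp)
    have h2 : ∀ᶠ y in nhds z, y ∈ Metric.ball z₀ (dist z z₀ + 1) :=
      Metric.isOpen_ball.mem_nhds (by simp)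
    obtain ⟨y, ⟨hy1, hy2⟩, hy3, hy4⟩ := (hacc.and_eventually (h1.and h2)).exists
    exact hy3 ⟨⟨hy2, hy4⟩, hy1⟩
  · obtain ⟨x, hx0, hx⟩ := heig z hz
    intro h
    have : x ∈ unboundedEigenspace T z := by
      rw [unboundedEigenspace, LinearMap.mem_ker]
      exact sub_eq_zero.2 hx
    rw [h, Submodule.mem_bot] at this
    exact hx0 (by rw [this]; rfl)
  · have hz' := sub_ne_zero.2 (hne z hz)
    have hfd := ContinuousLinearMap.finite_dimensional_eigenspace hRc _ (inv_ne_zero hz')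
    let g : unboundedEigenspace T z →ₗ[ℂ] Module.End.eigenspace (R : E →ₗ[ℂ] E) (z - z₀)⁻¹ :=
      LinearMap.codRestrict _ (T.domain.subtype ∘ₗ (unboundedEigenspace T z).subtype) (by
        intro x
        rw [Module.End.mem_eigenspace_iff]
        refine hR.apply_eigen (hne z hz) ?_
        exact sub_eq_zero.1 (LinearMap.mem_ker.1 x.2))
    refine FiniteDimensional.of_injective g fun x y hxy => ?_
    exact Subtype.ext (Subtype.ext (Subtype.mk.inj hxy))

end

/-! ### Weak solutions of linear ordinary differential equations. -/

section WeakDerivative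

open scoped ContDiff


theorem MeasureTheory.LocallyIntegrable.intervalIntegrable' {F : Type*}
    [NormedAddCommGroup F] {w : ℝ → F}
    (hw : LocallyIntegrable w) (a b : ℝ) : IntervalIntegrable w volume a b :=
  (hw.integrableOn_isCompact isCompact_uIcc).intervalIntegrable

variable {F : Type*} [NormedAddCommGroup F] [NormedSpace ℝ F]

/-- Fubini on the triangle `a ≤ s ≤ t ≤ b`, which the indicator in `G` cuts out of the square. -/
theorem integral_smul_primitive_eq [CompleteSpace F] {w : ℝ → F}
    (hw : LocallyIntegrable w) {k : ℝ → ℝ}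
    (hk : Continuous k) {a b : ℝ} (hab : a ≤ b) :
    ∫ t in a..b, k t • ∫ s in a..t, w s = ∫ s in a..b, (∫ t in s..b, k t) • w s := by
  set G : ℝ → ℝ → F := fun t s => {s | s ≤ t}.indicator (fun s => k t • w s) s with hG
  have hswap : ∫ t in a..b, ∫ s in a..b, G t s = ∫ s in a..b, ∫ t in a..b, G t s := by
    apply intervalIntegral_intervalIntegral_swap
    have h1 : G.uncurry = {p : ℝ × ℝ | p.2 ≤ p.1}.indicator (fun p => k p.1 • w p.2) := by
      ext ⟨t, s⟩
      simp [hG, Set.indicator_apply]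
    rw [h1]
    refine IntegrableOn.indicator ?_ (measurableSet_le measurable_snd measurable_fst)
    rw [IntegrableOn, Measure.volume_eq_prod, ← Measure.prod_restrict]
    exact Integrable.smul_prod
      ((hk.locallyIntegrable.integrableOn_isCompact isCompact_uIcc).mono_set Set.uIoc_subset_uIcc)
      ((hw.integrableOn_isCompact isCompact_uIcc).mono_set Set.uIoc_subset_uIcc)
  calc _ = ∫ t in a..b, ∫ s in a..b, G t s := by
        refine intervalIntegral.integral_congr fun t ht => ?_
        rw [Set.uIcc_of_le hab] at ht
        simp only [hG]
        rw [intervalIntegral.integral_indicator ht, intervalIntegral.integral_smul]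
    _ = ∫ s in a..b, ∫ t in a..b, G t s := hswap
    _ = _ := by
        refine intervalIntegral.integral_congr fun s hs => ?_
        rw [Set.uIcc_of_le hab] at hs
        have h1 : ∀ᵐ t : ℝ, t ∈ Set.uIoc a s → G t s = 0 := by
          filter_upwards [Measure.ae_ne volume s] with t hts ht
          rw [Set.uIoc_of_le hs.1] at ht
          simp only [hG]
          exact Set.indicator_of_notMem (s := {s | s ≤ t}) (fun h => hts (le_antisymm ht.2 h)) _
        have h2 : Set.EqOn (fun t => k t • w s) (fun t => G t s) (Set.uIoc s b) := by
          intro t ht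
          rw [Set.uIoc_of_le hs.2] at ht
          exact (Set.indicator_of_mem (s := {s | s ≤ t}) (f := fun s => k t • w s) ht.1.le).symm
        have i0 : IntervalIntegrable (fun _ : ℝ => (0 : F)) volume a s :=
          intervalIntegrable_const
        have i1 : IntervalIntegrable (fun t => G t s) volume a s :=
          i0.congr_ae ((ae_restrict_iff' measurableSet_uIoc).2
            (by filter_upwards [h1] with t ht h using (ht h).symm))
        have i2 : IntervalIntegrable (fun t => G t s) volume s b :=
          ((hk.smul continuous_const).intervalIntegrable s b).congr h2
        rw [← intervalIntegral.integral_add_adjacent_intervals i1 i2,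
          intervalIntegral.integral_congr_ae (g := fun _ => 0) h1,
          intervalIntegral.integral_zero, zero_add, ← intervalIntegral.integral_smul_const]
        exact intervalIntegral.integral_congr_ae
          (Filter.Eventually.of_forall fun t ht => (h2 ht).symm)

theorem HasCompactSupport.exists_support_subset_Ioc {g : ℝ → ℝ} (hg : HasCompactSupport g) :
    ∃ R : ℝ, 0 < R ∧ ∀ t, R ≤ |t| → g t = 0 := by
  obtain ⟨R, hR, h⟩ := hg.isCompact.isBounded.exists_pos_norm_lt
  refine ⟨R, hR, fun t ht => ?_⟩
  by_contra h0
  have := h t (subset_tsupport g h0)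
  rw [Real.norm_eq_abs] at this
  linarith

theorem integral_eq_intervalIntegral_of_eq_zero {f : ℝ → F} {R : ℝ}
    (h : ∀ t, R ≤ |t| → f t = 0) : ∫ t, f t = ∫ t in (-R)..R, f t := by
  refine (intervalIntegral.integral_eq_integral_of_support_subset fun t ht => ?_).symm
  have : |t| < R := by
    by_contra h0
    exact ht (h t (not_lt.1 h0))
  exact ⟨(abs_lt.1 this).1, (abs_lt.1 this).2.le⟩

theorem MeasureTheory.LocallyIntegrable.continuous_clm_apply {f : ℝ → F} (hf : LocallyIntegrable f)
    {N : ℝ → F →L[ℝ] F} (hN : Continuous N) : LocallyIntegrable (fun t => N t (f t)) := by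
  rw [locallyIntegrable_iff]
  intro K hK
  obtain ⟨C, hC⟩ := hK.exists_bound_of_continuousOn hN.continuousOn
  have hfK := hf.integrableOn_isCompact hK
  refine Integrable.mono' (hfK.norm.const_mul C) ?_ ?_
  · exact (ContinuousLinearMap.id ℝ (F →L[ℝ] F)).aestronglyMeasurable_comp₂
      hN.aestronglyMeasurable hfK.aestronglyMeasurable
  · refine (ae_restrict_iff' hK.measurableSet).2 (Filter.Eventually.of_forall fun t ht => ?_)
    exact (N t).le_of_opNorm_le (hC t ht) (f t)

variable [CompleteSpace F]

/-- Integration by parts for a primitive that need not be differentiable everywhere: after Fubini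
only `∫ t in s..M, deriv g t = -g s` is needed. -/
theorem integral_deriv_smul_primitive_eq {w : ℝ → F} (hw : LocallyIntegrable w) {g : ℝ → ℝ}
    (hg : ContDiff ℝ ∞ g) (hgs : HasCompactSupport g) :
    ∫ t, deriv g t • (∫ s in (0 : ℝ)..t, w s) = -∫ t, g t • w t := by
  obtain ⟨R, hR, h⟩ := hgs.exists_support_subset_Ioc
  obtain ⟨R', hR', h'⟩ := hgs.deriv.exists_support_subset_Ioc
  set M := max R R'
  have hM : 0 < M := lt_max_of_lt_left hR
  have hgM : ∀ t, M ≤ |t| → g t = 0 := fun t ht => h t ((le_max_left _ _).trans ht)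
  have hgM' : ∀ t, M ≤ |t| → deriv g t = 0 := fun t ht => h' t ((le_max_right _ _).trans ht)
  have hcd : Continuous (deriv g) := (contDiff_infty_iff_deriv.1 hg).2.continuous
  have hint : ∀ s, ∫ t in s..M, deriv g t = -g s := fun s => by
    rw [intervalIntegral.integral_deriv_eq_sub' g rfl
      (fun x _ => (contDiff_infty_iff_deriv.1 hg).1 x) hcd.continuousOn,
      hgM M (le_abs_self M), zero_sub]
  have hW := intervalIntegral.continuous_primitive (fun a b => hw.intervalIntegrable' a b)
  rw [integral_eq_intervalIntegral_of_eq_zero (R := M) (fun t ht => by rw [hgM' t ht, zero_smul]),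
    integral_eq_intervalIntegral_of_eq_zero (R := M) (f := fun t => g t • w t)
      (fun t ht => by rw [hgM t ht, zero_smul])]
  -- Moving the base point of the primitive from `0` to `-M` adds a constant, which integrates to
  -- zero against `deriv g`.
  have h1 : ∀ t, deriv g t • (∫ s in (0 : ℝ)..t, w s) =
      deriv g t • (∫ s in (0 : ℝ)..(-M), w s) + deriv g t • ∫ s in (-M)..t, w s := by
    intro t
    rw [← smul_add, intervalIntegral.integral_add_adjacent_intervals
      (hw.intervalIntegrable' _ _) (hw.intervalIntegrable' _ _)]
  have i1 : Continuous fun t => deriv g t • ∫ s in (0 : ℝ)..(-M), w s := hcd.smul continuous_const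
  have i2 : Continuous fun t => deriv g t • ∫ s in (-M)..t, w s := hcd.smul (hW _)
  simp_rw [h1]
  rw [intervalIntegral.integral_add (i1.intervalIntegrable _ _)
    (i2.intervalIntegrable _ _), intervalIntegral.integral_smul_const, hint,
    hgM (-M) (by rw [abs_neg]; exact le_abs_self M), neg_zero, zero_smul, zero_add,
    integral_smul_primitive_eq hw hcd (by linarith)]
  simp_rw [hint]
  simp

/-- A locally integrable function with vanishing weak derivative is constant. -/
theorem ae_eq_const_of_integral_deriv_smul_eq_zero {u : ℝ → F} (hu : LocallyIntegrable u)
    (h : ∀ g : ℝ → ℝ, ContDiff ℝ ∞ g → HasCompactSupport g → ∫ t, deriv g t • u t = 0) :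
    ∃ c : F, ∀ᵐ t, u t = c := by
  let η : ContDiffBump (0 : ℝ) := ⟨1, 2, one_pos, one_lt_two⟩
  set e : ℝ → ℝ := η.normed volume with he
  have he1 : ∫ t, e t = 1 := η.integral_normed
  have heC : ContDiff ℝ ∞ e := η.contDiff_normed
  have heS : HasCompactSupport e := η.hasCompactSupport_normed
  refine ⟨∫ t, e t • u t, ?_⟩
  refine ae_eq_of_integral_contDiff_smul_eq hu continuous_const.locallyIntegrable
    fun k hk hks => ?_
  set m : ℝ := ∫ t, k t with hm
  -- Subtracting the multiple of `e` with the same integral makes `k₀` the derivative of a compactly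
  -- supported function, namely `g` below.
  set k₀ : ℝ → ℝ := fun t => k t - m * e t with hk₀
  have hk₀C : ContDiff ℝ ∞ k₀ := hk.sub (contDiff_const.mul heC)
  have hk₀S : HasCompactSupport k₀ := hks.sub (heS.mul_left (f := fun _ => m))
  obtain ⟨R, hR, hz⟩ := hk₀S.exists_support_subset_Ioc
  have ik : Integrable k := hk.continuous.integrable_of_hasCompactSupport hks
  have ie : Integrable e := heC.continuous.integrable_of_hasCompactSupport heS
  have h0 : ∫ t, k₀ t = 0 := by
    rw [hk₀, integral_sub ik (ie.const_mul m), integral_const_mul, he1, mul_one, sub_self]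
  set g : ℝ → ℝ := fun t => ∫ s in (-R)..t, k₀ s with hg
  have hgd : ∀ t, HasDerivAt g (k₀ t) t := fun t =>
    hk₀C.continuous.integral_hasStrictDerivAt (-R) t |>.hasDerivAt
  have hgd' : deriv g = k₀ := funext fun t => (hgd t).deriv
  have hgC : ContDiff ℝ ∞ g := by
    rw [contDiff_infty_iff_deriv, hgd']
    exact ⟨fun t => (hgd t).differentiableAt, hk₀C⟩
  have hgS : HasCompactSupport g := by
    refine HasCompactSupport.intro (isCompact_Icc (a := -R) (b := R)) fun t ht => ?_
    rw [Set.mem_Icc, not_and_or, not_le, not_le] at ht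
    rcases ht with ht | ht
    · simp only [hg]
      rw [intervalIntegral.integral_symm, neg_eq_zero]
      refine intervalIntegral.integral_zero_ae (Filter.Eventually.of_forall fun s hs => ?_)
      rw [Set.uIoc_of_le ht.le] at hs
      refine hz s ?_
      rw [abs_of_nonpos (by linarith [hs.2])]
      linarith [hs.2]
    · simp only [hg]
      rw [← intervalIntegral.integral_add_adjacent_intervals
        (hk₀C.continuous.intervalIntegrable (-R) R) (hk₀C.continuous.intervalIntegrable R t),
        ← integral_eq_intervalIntegral_of_eq_zero hz, h0, zero_add]
      refine intervalIntegral.integral_zero_ae (Filter.Eventually.of_forall fun s hs => ?_)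
      rw [Set.uIoc_of_le ht.le] at hs
      refine hz s ?_
      rw [abs_of_nonneg (by linarith [hs.1])]
      exact hs.1.le
  have h2 := h g hgC hgS
  rw [hgd'] at h2
  have iku := hu.integrable_smul_left_of_hasCompactSupport hk.continuous hks
  have ieu := hu.integrable_smul_left_of_hasCompactSupport heC.continuous heS
  have h3 : ∀ t, k₀ t • u t = k t • u t - m • (e t • u t) := fun t => by
    rw [hk₀, sub_smul, mul_smul]
  simp_rw [h3] at h2
  have imeu : Integrable fun t => m • (e t • u t) := ieu.smul m
  rw [integral_sub iku imeu, integral_smul, sub_eq_zero] at h2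
  rw [h2, integral_smul_const]

/-- A weak solution of a linear ordinary differential equation is a classical solution. -/
theorem exists_hasDerivAt_of_weak_solution {f : ℝ → F} (hf : LocallyIntegrable f)
    {N : ℝ → F →L[ℝ] F} (hN : Continuous N)
    (h : ∀ g : ℝ → ℝ, ContDiff ℝ ∞ g → HasCompactSupport g →
      ∫ t, deriv g t • f t = -∫ t, g t • N t (f t)) :
    ∃ u : ℝ → F, f =ᵐ[volume] u ∧ ∀ t, HasDerivAt u (N t (u t)) t := by
  have hw := hf.continuous_clm_apply hN
  set W : ℝ → F := fun t => ∫ s in (0 : ℝ)..t, N s (f s) with hWdef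
  have hW : Continuous W :=
    intervalIntegral.continuous_primitive (fun a b => hw.intervalIntegrable' a b) 0
  obtain ⟨c, hc⟩ := ae_eq_const_of_integral_deriv_smul_eq_zero
    (u := fun t => f t - W t) (hf.sub hW.locallyIntegrable) fun g hg hgs => by
      have hcd : Continuous (deriv g) := (contDiff_infty_iff_deriv.1 hg).2.continuous
      simp_rw [smul_sub]
      rw [integral_sub (hf.integrable_smul_left_of_hasCompactSupport hcd hgs.deriv)
        (hW.locallyIntegrable.integrable_smul_left_of_hasCompactSupport hcd hgs.deriv),
        h g hg hgs, integral_deriv_smul_primitive_eq hw hg hgs, sub_self]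
  have hfu : f =ᵐ[volume] fun t => c + W t := by
    filter_upwards [hc] with t ht
    rw [← ht, sub_add_cancel]
  refine ⟨fun t => c + W t, hfu, fun t => ?_⟩
  -- Replacing `f` by its continuous representative makes the integrand continuous, so `W` is
  -- differentiable at every point.
  have hW2 : W = fun t => ∫ s in (0 : ℝ)..t, N s (c + W s) := by
    funext t
    refine intervalIntegral.integral_congr_ae ?_
    filter_upwards [hfu] with s hs _
    rw [hs]
  have hcont : Continuous fun s => N s (c + W s) := hN.clm_apply (continuous_const.add hW)
  exact ((hcont.integral_hasStrictDerivAt 0 t).hasDerivAt.const_add c).congr_of_eventuallyEq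
    (Filter.Eventually.of_forall fun x => congrArg (c + ·) (congrFun hW2 x))

end WeakDerivative

/-! ### Clifford identities, symmetry of `P`, and vanishing of its deficiency spaces. -/

section DiracEstimates

variable {H : Type*} [NormedAddCommGroup H] [InnerProductSpace ℝ H]
variable {Δ : Type*} [NormedAddCommGroup Δ] [InnerProductSpace ℂ Δ]

theorem inner_self_eq_ofReal_norm_sq (v : Δ) : ⟪v, v⟫_ℂ = ((‖v‖ ^ 2 : ℝ) : ℂ) :=
  (inner_self_eq_norm_sq_to_K v).trans (by push_cast; rfl)

section Clifford

variable [FiniteDimensional ℂ Δ] {ρ : CliffordAlg H →ₐ[ℝ] Module.End ℂ Δ}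

theorem IsSkewCliffordModule.inner_cliffordMul (hρ : IsSkewCliffordModule ρ) (x : H) (v w : Δ) :
    ⟪cliffordMul ρ x v, w⟫_ℂ = -⟪v, cliffordMul ρ x w⟫_ℂ :=
  hρ x v w

theorem cliffordMul_cliffordMul_self (ρ : CliffordAlg H →ₐ[ℝ] Module.End ℂ Δ) (x : H) (v : Δ) :
    cliffordMul ρ x (cliffordMul ρ x v) = -((‖x‖ ^ 2 : ℝ) • v) := by
  have h := congrArg (fun f => ρ f v) (CliffordAlgebra.ι_sq_scalar (negNormSqForm H) x)
  simp only [map_mul, AlgHom.commutes, negNormSqForm_apply] at h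
  rw [← neg_smul]
  exact h

theorem cliffordMul_anticomm (ρ : CliffordAlg H →ₐ[ℝ] Module.End ℂ Δ) {x y : H}
    (hxy : ⟪x, y⟫_ℝ = 0) (v : Δ) :
    cliffordMul ρ x (cliffordMul ρ y v) = -cliffordMul ρ y (cliffordMul ρ x v) := by
  have h := congrArg (fun f => ρ f v)
    (CliffordAlgebra.ι_mul_ι_add_swap (Q := negNormSqForm H) x y)
  have hp : QuadraticMap.polar (negNormSqForm H) x y = 0 := by
    rw [QuadraticMap.polar, negNormSqForm_apply, negNormSqForm_apply, negNormSqForm_apply,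
      norm_add_sq_real, hxy]
    ring
  rw [hp] at h
  simp only [map_mul, map_add, map_zero] at h
  exact eq_neg_of_add_eq_zero_left h

theorem IsSkewCliffordModule.norm_cliffordMul (hρ : IsSkewCliffordModule ρ) (x : H) (v : Δ) :
    ‖cliffordMul ρ x v‖ = ‖x‖ * ‖v‖ := by
  have h : ⟪cliffordMul ρ x v, cliffordMul ρ x v⟫_ℂ = ((‖x‖ * ‖v‖) ^ 2 : ℝ) := by
    rw [hρ.inner_cliffordMul, cliffordMul_cliffordMul_self, inner_neg_right, neg_neg,
      ← Complex.coe_smul, inner_smul_right, inner_self_eq_ofReal_norm_sq, mul_pow]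
    norm_cast
  rw [inner_self_eq_ofReal_norm_sq] at h
  have h2 : ‖cliffordMul ρ x v‖ ^ 2 = (‖x‖ * ‖v‖) ^ 2 := by exact_mod_cast h
  exact (sq_eq_sq₀ (norm_nonneg _) (by positivity)).1 h2

theorem IsSkewCliffordModule.inner_I_smul_cliffordMul (hρ : IsSkewCliffordModule ρ) (x : H)
    (v w : Δ) : ⟪Complex.I • cliffordMul ρ x v, w⟫_ℂ = ⟪v, Complex.I • cliffordMul ρ x w⟫_ℂ := by
  rw [inner_smul_left, inner_smul_right, hρ.inner_cliffordMul, Complex.conj_I]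
  ring

theorem continuous_cliffordMul_comp (ρ : CliffordAlg H →ₐ[ℝ] Module.End ℂ Δ) {Ω : ℝ → H}
    (hΩ : IsPolynomialFun Ω) : Continuous fun t => cliffordMul ρ (Ω t) :=
  (hasTemperateGrowth_cliffordMul ρ hΩ).1.continuous

end Clifford

section Schwartz

theorem SchwartzMap.integrable_inner (φ ψ : 𝓢(ℝ, Δ)) : Integrable fun t => ⟪φ t, ψ t⟫_ℂ := by
  refine (L2.integrable_inner (𝕜 := ℂ) (φ.toLp 2) (ψ.toLp 2)).congr ?_
  filter_upwards [φ.coeFn_toLp 2, ψ.coeFn_toLp 2] with t h1 h2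
  rw [h1, h2]

theorem SchwartzMap.integrable_norm_sq (φ : 𝓢(ℝ, Δ)) : Integrable fun t => ‖φ t‖ ^ 2 := by
  refine (φ.integrable_inner φ).re.congr (Filter.Eventually.of_forall fun t => ?_)
  simp only
  rw [inner_self_eq_norm_sq]

theorem inner_schwartzToL2 (φ ψ : 𝓢(ℝ, Δ)) :
    ⟪schwartzToL2 Δ φ, schwartzToL2 Δ ψ⟫_ℂ = ∫ t, ⟪φ t, ψ t⟫_ℂ :=
  inner_toL2_toL2_eq φ ψ

theorem MeasureTheory.L2.norm_sq_eq_integral (y : Lp Δ 2 (volume : Measure ℝ)) :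
    ‖y‖ ^ 2 = ∫ t, ‖y t‖ ^ 2 := by
  rw [← inner_self_eq_norm_sq (𝕜 := ℂ), L2.inner_def, ← integral_re (L2.integrable_inner y y)]
  simp_rw [inner_self_eq_norm_sq]

theorem norm_sq_schwartzToL2 (φ : 𝓢(ℝ, Δ)) : ‖schwartzToL2 Δ φ‖ ^ 2 = ∫ t, ‖φ t‖ ^ 2 := by
  rw [L2.norm_sq_eq_integral]
  refine integral_congr_ae ?_
  filter_upwards [φ.coeFn_toLp 2] with t h1
  rw [← h1]
  rfl

theorem dense_diracOp_domain [FiniteDimensional ℂ Δ]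
    (ρ : CliffordAlg H →ₐ[ℝ] Module.End ℂ Δ) (a : H) {Ω : ℝ → H}
    (hΩ : IsPolynomialFun Ω) :
    Dense ((diracOp ρ a hΩ).domain : Set (Lp Δ 2 (volume : Measure ℝ))) :=
  denseRange_toLpCLM (μ := (volume : Measure ℝ)) ENNReal.ofNat_ne_top

end Schwartz

variable [FiniteDimensional ℂ Δ] {ρ : CliffordAlg H →ₐ[ℝ] Module.End ℂ Δ} {a : H} {Ω : ℝ → H}

/-- The difference of the integrands is the derivative of `⟪a φ, ψ⟫`; the terms in `i Ω` cancel
pointwise, as `i` times a skew map is symmetric. -/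
theorem IsSkewCliffordModule.inner_diracSchwartz (hρ : IsSkewCliffordModule ρ) (a : H)
    (hΩ : IsPolynomialFun Ω) (φ ψ : 𝓢(ℝ, Δ)) :
    ∫ t, ⟪diracSchwartz ρ a hΩ φ t, ψ t⟫_ℂ = ∫ t, ⟪φ t, diracSchwartz ρ a hΩ ψ t⟫_ℂ := by
  rw [← sub_eq_zero, ← integral_sub (SchwartzMap.integrable_inner _ _)
    (SchwartzMap.integrable_inner _ _)]
  have hd : ∀ t, HasDerivAt (fun t => ⟪postcompCLM (𝕜 := ℂ) (cliffordMul ρ a) φ t, ψ t⟫_ℂ)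
      (⟪diracSchwartz ρ a hΩ φ t, ψ t⟫_ℂ - ⟪φ t, diracSchwartz ρ a hΩ ψ t⟫_ℂ) t := by
    intro t
    have h1 : HasDerivAt (fun t => cliffordMul ρ a (φ t)) (cliffordMul ρ a (deriv φ t)) t :=
      ((cliffordMul ρ a).restrictScalars ℝ).hasFDerivAt.comp_hasDerivAt t (φ.hasDerivAt t)
    convert! h1.inner ℂ (ψ.hasDerivAt t) using 1
    have e1 : ∀ χ : 𝓢(ℝ, Δ), diracSchwartz ρ a hΩ χ t = cliffordMul ρ a (deriv χ t) +
      Complex.I • cliffordMul ρ (Ω t) (χ t) := fun χ => diracSchwartz_apply ρ a hΩ χ t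
    rw [e1, e1, inner_add_left, inner_add_right, hρ.inner_I_smul_cliffordMul,
      hρ.inner_cliffordMul a (φ t)]
    ring
  exact integral_eq_zero_of_hasDerivAt_of_integrable hd
    ((SchwartzMap.integrable_inner _ _).sub (SchwartzMap.integrable_inner _ _))
    (SchwartzMap.integrable_inner _ _)

theorem IsSkewCliffordModule.isFormalAdjoint_diracOp (hρ : IsSkewCliffordModule ρ) (a : H)
    (hΩ : IsPolynomialFun Ω) : (diracOp ρ a hΩ).IsFormalAdjoint (diracOp ρ a hΩ) := by
  rintro ⟨_, φ, rfl⟩ ⟨_, ψ, rfl⟩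
  rw [diracOp_apply, diracOp_apply]
  simp only
  rw [inner_schwartzToL2, inner_schwartzToL2, hρ.inner_diracSchwartz]

open scoped ContDiff in
theorem IsSkewCliffordModule.eq_zero_of_inner_diracSchwartz_eq_zero [CompleteSpace Δ]
    (hρ : IsSkewCliffordModule ρ) (ha : a ≠ 0)
    (hΩ : IsPolynomialFun Ω) {z : ℂ} (hz : z.im ≠ 0) {y : Lp Δ 2 (volume : Measure ℝ)}
    (hy : ∀ φ : 𝓢(ℝ, Δ),
      ⟪schwartzToL2 Δ (diracSchwartz ρ a hΩ φ) - z • schwartzToL2 Δ φ, y⟫_ℂ = 0) :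
    y = 0 := by
  have ha' : ‖a‖ ^ 2 ≠ 0 := pow_ne_zero 2 (norm_ne_zero_iff.2 ha)
  -- The equation `a u' + i Ω u = z̄ u` solved for `u'`, using `a² = -‖a‖²`.
  set N : ℝ → Δ →L[ℝ] Δ := fun t => ((‖a‖ ^ 2)⁻¹ : ℝ) • ((cliffordMul ρ a ∘L
    (Complex.I • cliffordMul ρ (Ω t) - starRingEnd ℂ z •
      ContinuousLinearMap.id ℂ Δ)).restrictScalars ℝ)
    with hN
  have hNa : ∀ t v, N t v = ((‖a‖ ^ 2)⁻¹ : ℝ) • cliffordMul ρ a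
    (Complex.I • cliffordMul ρ (Ω t) v - starRingEnd ℂ z • v) := fun t v => rfl
  have hNc : Continuous N := by
    have h1 : Continuous fun t => cliffordMul ρ a ∘L
        (Complex.I • cliffordMul ρ (Ω t) - starRingEnd ℂ z • ContinuousLinearMap.id ℂ Δ) :=
      continuous_const.clm_comp
        (((continuous_cliffordMul_comp ρ hΩ).const_smul Complex.I).sub continuous_const)
    exact ((ContinuousLinearMap.restrictScalarsL ℂ Δ Δ ℝ ℝ).continuous.comp h1).const_smul
      ((‖a‖ ^ 2)⁻¹ : ℝ)
  have hyM : MemLp y 2 volume := Lp.memLp y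
  have hyL : LocallyIntegrable y volume := hyM.locallyIntegrable one_le_two
  have hNyL := hyL.continuous_clm_apply hNc
  have hweak : ∀ g : ℝ → ℝ, ContDiff ℝ ∞ g → HasCompactSupport g →
      ∫ t, deriv g t • y t = -∫ t, g t • N t (y t) := by
    intro g hg hgs
    have hcd : Continuous (deriv g) := (contDiff_infty_iff_deriv.1 hg).2.continuous
    have i1 := hyL.integrable_smul_left_of_hasCompactSupport hcd hgs.deriv
    have i2 := hNyL.integrable_smul_left_of_hasCompactSupport hg.continuous hgs
    rw [← add_eq_zero_iff_eq_neg, ← integral_add i1 i2]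
    refine ext_inner_left ℂ fun v => ?_
    have i12 : Integrable fun t => deriv g t • y t + g t • N t (y t) := i1.add i2
    rw [inner_zero_right, ← integral_inner i12]
    -- With the factor `a`, the derivative term of `P φ` becomes `-‖a‖² g' v`, so the arbitrary
    -- vector `v` tests the weak equation directly.
    set φ : 𝓢(ℝ, Δ) := HasCompactSupport.toSchwartzMap (f := fun t => g t • cliffordMul ρ a v)
      (hgs.smul_right) (hg.smul contDiff_const) with hφ
    have h0 := hy φ
    rw [← map_smul, ← map_sub, L2.inner_def] at h0
    have h1 : (fun t => ⟪(schwartzToL2 Δ (diracSchwartz ρ a hΩ φ - z • φ) : ℝ → Δ) t, y t⟫_ℂ)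
        =ᵐ[volume] fun t => -(‖a‖ ^ 2 : ℝ) * ⟪v, deriv g t • y t + g t • N t (y t)⟫_ℂ := by
      filter_upwards [(diracSchwartz ρ a hΩ φ - z • φ).coeFn_toLp 2] with t ht
      have e0 : (schwartzToL2 Δ (diracSchwartz ρ a hΩ φ - z • φ) : ℝ → Δ) t =
          cliffordMul ρ a (deriv φ t) + Complex.I • cliffordMul ρ (Ω t) (φ t) - z • φ t :=
        ht.trans (by rw [sub_apply, diracSchwartz_apply]; rfl)
      have e1 : deriv φ t = deriv g t • cliffordMul ρ a v :=
        (((contDiff_infty_iff_deriv.1 hg).1 t).hasDerivAt.smul_const _).deriv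
      have e2 : φ t = g t • cliffordMul ρ a v := rfl
      rw [e0, inner_sub_left, inner_add_left, hρ.inner_I_smul_cliffordMul, hρ.inner_cliffordMul,
        e1, e2, hNa, inner_add_right]
      simp only [← Complex.coe_smul, inner_smul_left, inner_smul_right, map_sub, inner_sub_right,
        map_smul, hρ.inner_cliffordMul a v, Complex.conj_ofReal,
        cliffordMul_cliffordMul_self, inner_neg_right]
      have : ((‖a‖ : ℝ) : ℂ) ≠ 0 := by exact_mod_cast norm_ne_zero_iff.2 ha
      push_cast
      field_simp
      ring
    rw [integral_congr_ae h1, integral_const_mul] at h0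
    rcases mul_eq_zero.1 h0 with h | h
    · exact absurd h (by exact_mod_cast neg_ne_zero.2 ha')
    · exact h
  obtain ⟨u, hyu, hu⟩ := exists_hasDerivAt_of_weak_solution hyL hNc hweak
  have huM : MemLp u 2 volume := (memLp_congr_ae hyu).1 hyM
  have hiu : Integrable fun t => ‖u t‖ ^ 2 := huM.integrable_norm_pow two_ne_zero
  -- The symmetric terms `i Ω` cancel and only the imaginary part of `z` survives.
  have hd : ∀ t, HasDerivAt (fun t => ⟪cliffordMul ρ a (u t), u t⟫_ℂ)
      ((z - starRingEnd ℂ z) * ((‖u t‖ ^ 2 : ℝ) : ℂ)) t := by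
    intro t
    have h1 : HasDerivAt (fun t => cliffordMul ρ a (u t)) (cliffordMul ρ a (N t (u t))) t :=
      ((cliffordMul ρ a).restrictScalars ℝ).hasFDerivAt.comp_hasDerivAt t (hu t)
    convert! h1.inner ℂ (hu t) using 1
    have e : cliffordMul ρ a (N t (u t)) =
        -(Complex.I • cliffordMul ρ (Ω t) (u t) - starRingEnd ℂ z • u t) := by
      rw [hNa, ← Complex.coe_smul, map_smul, cliffordMul_cliffordMul_self, smul_neg,
        Complex.coe_smul, inv_smul_smul₀ ha']
    rw [hρ.inner_cliffordMul, e, inner_neg_right, neg_neg, inner_neg_left, inner_sub_left,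
      inner_sub_right, hρ.inner_I_smul_cliffordMul, inner_smul_left,
      inner_smul_right (u t) (u t), inner_self_eq_ofReal_norm_sq, Complex.conj_conj]
    push_cast
    ring
  have hid : Integrable fun t => (z - starRingEnd ℂ z) * ((‖u t‖ ^ 2 : ℝ) : ℂ) :=
    hiu.ofReal.const_mul _
  have hcu : Continuous u := continuous_iff_continuousAt.2 fun t => (hu t).continuousAt
  have hi : Integrable fun t => ⟪cliffordMul ρ a (u t), u t⟫_ℂ := by
    refine (hiu.const_mul ‖a‖).mono'
      (((cliffordMul ρ a).continuous.comp hcu).inner hcu).aestronglyMeasurable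
      (Filter.Eventually.of_forall fun t => (norm_inner_le_norm _ _).trans ?_)
    rw [hρ.norm_cliffordMul]
    exact le_of_eq (by ring)
  have h0 := integral_eq_zero_of_hasDerivAt_of_integrable hd hid hi
  rw [integral_const_mul, integral_complex_ofReal] at h0
  have hzz : z - starRingEnd ℂ z ≠ 0 := fun h =>
    hz (Complex.conj_eq_iff_im.1 (sub_eq_zero.1 h).symm)
  have h1 : ∫ t, ‖u t‖ ^ 2 = 0 := by exact_mod_cast (mul_eq_zero.1 h0).resolve_left hzz
  rw [← norm_eq_zero, ← sq_eq_zero_iff, L2.norm_sq_eq_integral, ← h1]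
  refine integral_congr_ae ?_
  filter_upwards [hyu] with t ht
  rw [ht]

end DiracEstimates

/-! ### Growth of the potential `‖Ω‖² - r ‖Ω'‖`. -/

section PolynomialGrowth

variable {H : Type*} [NormedAddCommGroup H] [InnerProductSpace ℝ H]

theorem IsPolynomialFun.exists_hasDerivAt {Ω : ℝ → H} (hΩ : IsPolynomialFun Ω) :
    ∃ Ω' : ℝ → H, IsPolynomialFun Ω' ∧ ∀ t, HasDerivAt Ω (Ω' t) t := by
  obtain ⟨n, c, hc⟩ := hΩ
  refine ⟨fun t => ∑ k ∈ Finset.range (n - 1), t ^ k • ((k + 1 : ℝ) • c (k + 1)),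
    ⟨n - 1, fun k => (k + 1 : ℝ) • c (k + 1), fun t => rfl⟩, fun t => ?_⟩
  have h : ∀ t, HasDerivAt (fun t : ℝ => ∑ k ∈ Finset.range n, t ^ k • c k)
      (∑ k ∈ Finset.range n, ((k : ℝ) * t ^ (k - 1)) • c k) t := fun t =>
    HasDerivAt.fun_sum fun k _ => (hasDerivAt_pow k t).smul_const (c k)
  rw [show Ω = fun t : ℝ => ∑ k ∈ Finset.range n, t ^ k • c k from funext hc]
  convert! h t using 1
  rcases n with _ | n
  · simp
  · rw [Finset.sum_range_succ' _ n]
    simp only [Nat.add_sub_cancel, CharP.cast_eq_zero, zero_mul, zero_smul, add_zero, smul_smul]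
    refine Finset.sum_congr rfl fun k _ => ?_
    push_cast
    rw [mul_comm]

theorem IsPolynomialFun.exists_degree {Ω : ℝ → H} (hΩ : IsPolynomialFun Ω)
    (hne : ¬ ∃ c : H, ∀ t : ℝ, Ω t = c) :
    ∃ (m : ℕ) (c : ℕ → H), c (m + 1) ≠ 0 ∧
      ∀ t, Ω t = (∑ k ∈ Finset.range (m + 1), t ^ k • c k) + t ^ (m + 1) • c (m + 1) := by
  obtain ⟨n, c, hc⟩ := hΩ
  induction n with
  | zero => exact absurd ⟨0, fun t => by simp [hc t]⟩ hne
  | succ n ih =>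
    by_cases h : c n = 0
    · exact ih fun t => by rw [hc t, Finset.sum_range_succ, h, smul_zero, add_zero]
    · rcases n with _ | m
      · exact absurd ⟨c 0, fun t => by simp [hc t]⟩ hne
      · exact ⟨m, c, h, fun t => by rw [hc t, Finset.sum_range_succ]⟩

theorem norm_sum_pow_smul_le (c : ℕ → H) (m : ℕ) {t : ℝ} (ht : 1 ≤ |t|) :
    ‖∑ k ∈ Finset.range (m + 1), t ^ k • c k‖ ≤ |t| ^ m * ∑ k ∈ Finset.range (m + 1), ‖c k‖ := by
  rw [Finset.mul_sum]
  refine norm_sum_le_of_le _ fun k hk => ?_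
  rw [norm_smul, norm_pow, Real.norm_eq_abs]
  gcongr
  exact Nat.lt_succ_iff.1 (Finset.mem_range.1 hk)

/-- The square of a non-constant polynomial function dominates its derivative. -/
theorem IsPolynomialFun.exists_growth {Ω Ω' : ℝ → H} (hΩ : IsPolynomialFun Ω)
    (hd : ∀ t, HasDerivAt Ω (Ω' t) t) (hne : ¬ ∃ c : H, ∀ t : ℝ, Ω t = c) {r : ℝ} (hr : 0 ≤ r) :
    ∃ T : ℝ, 0 < T ∧ ∀ t, T ≤ |t| → |t| ≤ ‖Ω t‖ ^ 2 - r * ‖Ω' t‖ := by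
  obtain ⟨m, c, hc0, hc⟩ := hΩ.exists_degree hne
  set κ := ‖c (m + 1)‖ with hκ
  have hκ0 : 0 < κ := norm_pos_iff.2 hc0
  set S := ∑ k ∈ Finset.range (m + 1), ‖c k‖ with hS
  have hS0 : 0 ≤ S := Finset.sum_nonneg fun _ _ => norm_nonneg _
  set d : ℕ → H := fun k => ((k + 1 : ℕ) : ℝ) • c (k + 1) with hdd
  set S' := ∑ k ∈ Finset.range (m + 1), ‖d k‖ with hS'
  have hS'0 : 0 ≤ S' := Finset.sum_nonneg fun _ _ => norm_nonneg _
  have hΩ' : ∀ t, Ω' t = ∑ k ∈ Finset.range (m + 1), t ^ k • d k := by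
    intro t
    refine (hd t).unique ?_
    have h : HasDerivAt (fun t : ℝ => ∑ k ∈ Finset.range (m + 1 + 1), t ^ k • c k)
        (∑ k ∈ Finset.range (m + 1 + 1), ((k : ℝ) * t ^ (k - 1)) • c k) t :=
      HasDerivAt.fun_sum fun k _ => (hasDerivAt_pow k t).smul_const (c k)
    rw [show Ω = fun t : ℝ => ∑ k ∈ Finset.range (m + 1 + 1), t ^ k • c k from
      funext fun t => by rw [hc t, ← Finset.sum_range_succ]]
    convert! h using 1
    rw [Finset.sum_range_succ' _ (m + 1)]
    simp only [hdd, Nat.add_sub_cancel, CharP.cast_eq_zero, zero_mul, zero_smul, add_zero,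
      smul_smul]
    exact Finset.sum_congr rfl fun k _ => by rw [mul_comm]
  -- The second summand makes the leading term at least twice the rest, so `‖Ω t‖` is at least half
  -- the leading term. The third makes the square of that half exceed `r * ‖Ω' t‖` by at least
  -- `|t|`.
  set T := 1 + 2 * S / κ + 4 * (r * S' + 1) / κ ^ 2 with hT
  refine ⟨T, by positivity, fun t ht => ?_⟩
  have h1 : 0 ≤ 2 * S / κ := by positivity
  have h2 : 0 ≤ 4 * (r * S' + 1) / κ ^ 2 := by positivity
  have ht1 : 1 ≤ |t| := by linarith
  have ht2 : 2 * S ≤ κ * |t| := by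
    rw [← div_le_iff₀' hκ0]; linarith
  have ht3 : 4 * (r * S' + 1) ≤ κ ^ 2 * |t| := by
    rw [← div_le_iff₀' (by positivity)]; linarith
  set p := |t| ^ m with hp
  have hp1 : 1 ≤ p := one_le_pow₀ ht1
  have hlow : p * (κ * |t|) / 2 ≤ ‖Ω t‖ := by
    have e1 : ‖t ^ (m + 1) • c (m + 1)‖ = p * (κ * |t|) := by
      rw [norm_smul, norm_pow, Real.norm_eq_abs, pow_succ, ← hκ]; ring
    have e2 := norm_sum_pow_smul_le c m ht1
    have e3 := norm_sub_norm_le (t ^ (m + 1) • c (m + 1))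
      (-∑ k ∈ Finset.range (m + 1), t ^ k • c k)
    rw [sub_neg_eq_add, add_comm (t ^ (m + 1) • c (m + 1)), ← hc t, norm_neg, e1] at e3
    have e4 : p * (2 * S) ≤ p * (κ * |t|) := by gcongr
    rw [← hp, ← hS] at e2
    linarith
  have hup : ‖Ω' t‖ ≤ p * S' := by rw [hΩ' t]; exact norm_sum_pow_smul_le d m ht1
  have hsq : (p * (κ * |t|) / 2) ^ 2 ≤ ‖Ω t‖ ^ 2 := by gcongr
  have hrp : r * ‖Ω' t‖ ≤ r * (p * S') := by gcongr
  have f1 : p * |t| * (4 * (r * S' + 1)) ≤ p * |t| * (κ ^ 2 * |t|) := by gcongr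
  have f2 : p * |t| * (κ ^ 2 * |t|) ≤ p * (p * |t| * (κ ^ 2 * |t|)) :=
    le_mul_of_one_le_left (by positivity) hp1
  have f3 : p * S' * r ≤ p * |t| * (S' * r) := by
    rw [mul_assoc]
    gcongr
    exact le_mul_of_one_le_right (by positivity) ht1
  have f4 : |t| ≤ p * |t| := le_mul_of_one_le_left (by positivity) hp1
  nlinarith

theorem IsPolynomialFun.continuous {Ω : ℝ → H} (hΩ : IsPolynomialFun Ω) : Continuous Ω := by
  obtain ⟨Ω', -, h⟩ := hΩ.exists_hasDerivAt
  exact continuous_iff_continuousAt.2 fun t => (h t).continuousAt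

/-- `C` bounds the potential on a compact interval and does not depend on `M`. This order of
quantifiers matters: `M` is later chosen in terms of `C`. -/
theorem IsPolynomialFun.exists_lower_bound {Ω Ω' : ℝ → H} (hΩ : IsPolynomialFun Ω)
    (hΩ' : IsPolynomialFun Ω')
    (hd : ∀ t, HasDerivAt Ω (Ω' t) t) (hne : ¬ ∃ c : H, ∀ t : ℝ, Ω t = c) {r : ℝ} (hr : 0 ≤ r) :
    ∃ C : ℝ, 0 ≤ C ∧ ∀ M : ℝ, ∃ N : ℝ, 0 < N ∧
      ∀ t, (if N ≤ |t| then M else 0) - C ≤ ‖Ω t‖ ^ 2 - r * ‖Ω' t‖ := by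
  obtain ⟨T, hT, h⟩ := hΩ.exists_growth hd hne hr
  have hcont : Continuous fun t => ‖Ω t‖ ^ 2 - r * ‖Ω' t‖ :=
    (hΩ.continuous.norm.pow 2).sub (hΩ'.continuous.norm.const_mul r)
  obtain ⟨C, hC⟩ := (isCompact_Icc (a := -T) (b := T)).exists_bound_of_continuousOn
    hcont.continuousOn
  refine ⟨|C|, abs_nonneg C, fun M => ⟨max T M, lt_max_of_lt_left hT, fun t => ?_⟩⟩
  split_ifs with ht
  · have := h t ((le_max_left _ _).trans ht)
    have := (le_max_right T M).trans ht
    linarith [abs_nonneg C]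
  · rcases le_total T |t| with h1 | h1
    · linarith [h t h1, abs_nonneg t, abs_nonneg C]
    · have := hC t (Set.mem_Icc.2 (abs_le.1 h1))
      rw [Real.norm_eq_abs] at this
      linarith [neg_abs_le (‖Ω t‖ ^ 2 - r * ‖Ω' t‖), le_abs_self C]

end PolynomialGrowth

/-! ### The energy estimate. -/

section Energy

variable {H : Type*} [NormedAddCommGroup H] [InnerProductSpace ℝ H] [FiniteDimensional ℝ H]
variable {Δ : Type*} [NormedAddCommGroup Δ] [InnerProductSpace ℂ Δ] [FiniteDimensional ℂ Δ]
variable {ρ : CliffordAlg H →ₐ[ℝ] Module.End ℂ Δ} {a : H} {Ω Ω' : ℝ → H}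

theorem hasDerivAt_cliffordMul_apply (ρ : CliffordAlg H →ₐ[ℝ] Module.End ℂ Δ)
    {x x' : ℝ → H} {v v' : ℝ → Δ} {t : ℝ} (hx : HasDerivAt x (x' t) t)
    (hv : HasDerivAt v (v' t) t) : HasDerivAt (fun t => cliffordMul ρ (x t) (v t))
      (cliffordMul ρ (x' t) (v t) + cliffordMul ρ (x t) (v' t)) t := by
  let L : H →L[ℝ] (Δ →L[ℝ] Δ) := LinearMap.toContinuousLinearMap
    ((ContinuousLinearMap.restrictScalarsₗ ℂ Δ Δ ℝ ℝ) ∘ₗ cliffordMul ρ)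
  have h : HasDerivAt (fun t => L (x t)) (L (x' t)) t := L.hasFDerivAt.comp_hasDerivAt t hx
  exact h.clm_apply hv

/-- Expanding `‖Pφ‖²` leaves the cross term `2 Re ⟪a φ', i Ω φ⟫`. It equals the real part of the
derivative `q` of `⟪a φ, i Ω φ⟫`, which integrates to zero, minus `Re ⟪a φ, i Ω' φ⟫`, which is at
most `‖a‖ ‖Ω'‖ ‖φ‖²` in absolute value. -/
theorem IsSkewCliffordModule.energy_le (hρ : IsSkewCliffordModule ρ)
    (hΩ : IsPolynomialFun Ω) (hΩ' : IsPolynomialFun Ω') (hd : ∀ t, HasDerivAt Ω (Ω' t) t)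
    (horth : ∀ t : ℝ, ⟪a, Ω t⟫_ℝ = 0) {C M N : ℝ}
    (hW : ∀ t, (if N ≤ |t| then M else 0) - C ≤ ‖Ω t‖ ^ 2 - ‖a‖ * ‖Ω' t‖) (φ : 𝓢(ℝ, Δ)) :
    ‖a‖ ^ 2 * (∫ t, ‖deriv φ t‖ ^ 2) + M * (∫ t in {t | N ≤ |t|}, ‖φ t‖ ^ 2) ≤
      ‖schwartzToL2 Δ (diracSchwartz ρ a hΩ φ)‖ ^ 2 + C * ‖schwartzToL2 Δ φ‖ ^ 2 := by
  set A : 𝓢(ℝ, Δ) →L[ℂ] 𝓢(ℝ, Δ) := postcompCLM (𝕜 := ℂ) (cliffordMul ρ a)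
  set B : 𝓢(ℝ, Δ) →L[ℂ] 𝓢(ℝ, Δ) := Complex.I • bilinLeftCLM (ContinuousLinearMap.apply ℂ Δ)
      (hasTemperateGrowth_cliffordMul ρ hΩ)
  set B' : 𝓢(ℝ, Δ) →L[ℂ] 𝓢(ℝ, Δ) := Complex.I • bilinLeftCLM (ContinuousLinearMap.apply ℂ Δ)
      (hasTemperateGrowth_cliffordMul ρ hΩ')
  set D : 𝓢(ℝ, Δ) →L[ℂ] 𝓢(ℝ, Δ) := derivCLM ℂ Δ
  have hA : ∀ (χ : 𝓢(ℝ, Δ)) t, A χ t = cliffordMul ρ a (χ t) := fun χ t => rfl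
  have hB : ∀ (χ : 𝓢(ℝ, Δ)) t, B χ t = Complex.I • cliffordMul ρ (Ω t) (χ t) := fun χ t => rfl
  have hB' : ∀ (χ : 𝓢(ℝ, Δ)) t, B' χ t = Complex.I • cliffordMul ρ (Ω' t) (χ t) := fun χ t => rfl
  have hP : ∀ t, diracSchwartz ρ a hΩ φ t = A (D φ) t + B φ t := fun t => rfl
  set q : ℝ → ℂ := fun t => ⟪A φ t, B' φ t + B (D φ) t⟫_ℂ + ⟪A (D φ) t, B φ t⟫_ℂ with hq
  have hder : ∀ t, HasDerivAt (fun t => ⟪A φ t, B φ t⟫_ℂ) (q t) t := by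
    intro t
    have h1 : HasDerivAt (A φ) (A (D φ) t) t :=
      ((cliffordMul ρ a).restrictScalars ℝ).hasFDerivAt.comp_hasDerivAt t (φ.hasDerivAt t)
    have h2 : HasDerivAt (B φ) (B' φ t + B (D φ) t) t := by
      have := (hasDerivAt_cliffordMul_apply (v' := deriv φ) ρ (hd t) (φ.hasDerivAt t)).const_smul
        Complex.I
      rw [smul_add] at this
      exact this
    exact h1.inner ℂ h2
  have hqi : Integrable q := by
    have h1 : Integrable fun t => ⟪A φ t, (B' φ + B (D φ)) t⟫_ℂ := SchwartzMap.integrable_inner _ _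
    exact h1.add (SchwartzMap.integrable_inner _ _)
  have hq0 : ∫ t, (q t).re = 0 := by
    have := integral_re hqi
    rw [integral_eq_zero_of_hasDerivAt_of_integrable hder hqi (SchwartzMap.integrable_inner _ _)]
      at this
    exact this
  have hpt : ∀ t, ‖a‖ ^ 2 * ‖D φ t‖ ^ 2 + M * {t | N ≤ |t|}.indicator (fun t => ‖φ t‖ ^ 2) t ≤
      ‖diracSchwartz ρ a hΩ φ t‖ ^ 2 + C * ‖φ t‖ ^ 2 - (q t).re := by
    intro t
    have e1 : ‖diracSchwartz ρ a hΩ φ t‖ ^ 2 =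
        (‖a‖ * ‖D φ t‖) ^ 2 + 2 * (⟪A (D φ) t, B φ t⟫_ℂ).re + (‖Ω t‖ * ‖φ t‖) ^ 2 := by
      rw [hP, norm_add_sq (𝕜 := ℂ), hA, hρ.norm_cliffordMul, hB, norm_smul, hρ.norm_cliffordMul,
        Complex.norm_I, one_mul]
      rfl
    -- Here `a ⟂ Ω` enters: anticommutation makes the two terms containing `φ'` add up instead of
    -- cancelling.
    have e2 : (⟪A φ t, B (D φ) t⟫_ℂ).re = (⟪A (D φ) t, B φ t⟫_ℂ).re := by
      have h1 : Complex.I • cliffordMul ρ (Ω t) (cliffordMul ρ a (φ t)) =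
          -cliffordMul ρ a (Complex.I • cliffordMul ρ (Ω t) (φ t)) := by
        rw [map_smul, cliffordMul_anticomm ρ (horth t), smul_neg, neg_neg]
      rw [hA, hA, hB, hB, ← hρ.inner_I_smul_cliffordMul, h1, inner_neg_left,
        hρ.inner_cliffordMul, neg_neg, ← inner_conj_symm, Complex.conj_re]
    have e3 : |(⟪A φ t, B' φ t⟫_ℂ).re| ≤ ‖a‖ * ‖Ω' t‖ * ‖φ t‖ ^ 2 := by
      refine (Complex.abs_re_le_norm _).trans ((norm_inner_le_norm _ _).trans ?_)
      rw [hA, hB', norm_smul, hρ.norm_cliffordMul, hρ.norm_cliffordMul, Complex.norm_I]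
      exact le_of_eq (by ring)
    have e4 : (q t).re = (⟪A φ t, B' φ t⟫_ℂ).re + 2 * (⟪A (D φ) t, B φ t⟫_ℂ).re := by
      rw [hq]
      simp only [inner_add_right, Complex.add_re, e2]
      ring
    have e5 := mul_le_mul_of_nonneg_right (hW t) (sq_nonneg ‖φ t‖)
    have e6 : {t | N ≤ |t|}.indicator (fun t => ‖φ t‖ ^ 2) t * M =
        (if N ≤ |t| then M else 0) * ‖φ t‖ ^ 2 := by
      by_cases ht : N ≤ |t|
      · rw [Set.indicator_of_mem (s := {t | N ≤ |t|}) ht, if_pos ht, mul_comm]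
      · rw [Set.indicator_of_notMem (s := {t | N ≤ |t|}) ht, if_neg ht, zero_mul, zero_mul]
    rw [e1, e4]
    nlinarith [le_abs_self (⟪A φ t, B' φ t⟫_ℂ).re]
  have hS : MeasurableSet {t : ℝ | N ≤ |t|} := measurableSet_le measurable_const measurable_norm
  have i1 : Integrable fun t => ‖a‖ ^ 2 * ‖D φ t‖ ^ 2 := (D φ).integrable_norm_sq.const_mul _
  have i2 : Integrable fun t => M * {t | N ≤ |t|}.indicator (fun t => ‖φ t‖ ^ 2) t :=
    (φ.integrable_norm_sq.indicator hS).const_mul M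
  have i3 : Integrable fun t => ‖diracSchwartz ρ a hΩ φ t‖ ^ 2 := SchwartzMap.integrable_norm_sq _
  have i4 : Integrable fun t => C * ‖φ t‖ ^ 2 := φ.integrable_norm_sq.const_mul _
  have i34 : Integrable fun t => ‖diracSchwartz ρ a hΩ φ t‖ ^ 2 + C * ‖φ t‖ ^ 2 := i3.add i4
  have i5 : Integrable fun t => (q t).re := hqi.re
  have i12 : Integrable fun t => ‖a‖ ^ 2 * ‖D φ t‖ ^ 2 +
    M * {t | N ≤ |t|}.indicator (fun t => ‖φ t‖ ^ 2) t := i1.add i2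
  have i345 : Integrable fun t => ‖diracSchwartz ρ a hΩ φ t‖ ^ 2 + C * ‖φ t‖ ^ 2 - (q t).re :=
    i34.sub i5
  have h := integral_mono i12 i345 hpt
  rw [integral_sub i34 i5, integral_add i3 i4, integral_add i1 i2, hq0, sub_zero,
    integral_const_mul, integral_const_mul, integral_const_mul, integral_indicator hS] at h
  rw [norm_sq_schwartzToL2, norm_sq_schwartzToL2]
  exact h

end Energy

/-! ### Approximation by step functions in `L²`. -/

section StepApproximation

variable {Δ : Type*} [NormedAddCommGroup Δ] [InnerProductSpace ℂ Δ]

/-- Cauchy–Schwarz against the constant `1`, read off from the non-negative integral of `((b - a) f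
- I)²`. -/
theorem sq_integral_le_mul_integral_sq {f : ℝ → ℝ} (hf : Continuous f) {a b : ℝ} (hab : a ≤ b) :
    (∫ t in a..b, f t) ^ 2 ≤ (b - a) * ∫ t in a..b, f t ^ 2 := by
  rcases hab.eq_or_lt with rfl | hlt
  · simp
  set I := ∫ t in a..b, f t with hI
  have h0 : 0 ≤ ∫ t in a..b, ((b - a) * f t - I) ^ 2 :=
    intervalIntegral.integral_nonneg hab fun t _ => sq_nonneg _
  have h1 : ∫ t in a..b, ((b - a) * f t - I) ^ 2 =
      (b - a) * ((b - a) * (∫ t in a..b, f t ^ 2) - I ^ 2) := by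
    have e : ∀ t, ((b - a) * f t - I) ^ 2 =
        (b - a) ^ 2 * f t ^ 2 - (2 * (b - a) * I) * f t + I ^ 2 := fun t => by ring
    simp_rw [e]
    have c1 : Continuous fun t => (b - a) ^ 2 * f t ^ 2 := by fun_prop
    have c2 : Continuous fun t => (2 * (b - a) * I) * f t := by fun_prop
    have c12 : Continuous fun t => (b - a) ^ 2 * f t ^ 2 - (2 * (b - a) * I) * f t := by fun_prop
    rw [intervalIntegral.integral_add (c12.intervalIntegrable _ _)
      (continuous_const.intervalIntegrable _ _),
      intervalIntegral.integral_sub (c1.intervalIntegrable _ _) (c2.intervalIntegrable _ _),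
      intervalIntegral.integral_const_mul, intervalIntegral.integral_const_mul,
      intervalIntegral.integral_const, smul_eq_mul, ← hI]
    ring
  rw [h1] at h0
  have := nonneg_of_mul_nonneg_right h0 (sub_pos.2 hlt)
  linarith

theorem norm_sub_sq_le_mul_integral {F : Type*} [NormedAddCommGroup F] [NormedSpace ℝ F]
    [CompleteSpace F] {u u' : ℝ → F}
    (hu : ∀ t, HasDerivAt u (u' t) t) (hu' : Continuous u') {a b t : ℝ} (ht : t ∈ Set.Icc a b) :
    ‖u t - u a‖ ^ 2 ≤ (b - a) * ∫ s in a..b, ‖u' s‖ ^ 2 := by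
  have h1 : ‖u t - u a‖ ≤ ∫ s in a..t, ‖u' s‖ := by
    rw [← intervalIntegral.integral_eq_sub_of_hasDerivAt (fun s _ => hu s)
      (hu'.intervalIntegrable _ _)]
    exact intervalIntegral.norm_integral_le_integral_norm ht.1
  have h2 : ∫ s in a..t, ‖u' s‖ ^ 2 ≤ ∫ s in a..b, ‖u' s‖ ^ 2 :=
    intervalIntegral.integral_mono_interval le_rfl ht.1 ht.2
      (Filter.Eventually.of_forall fun s => sq_nonneg _)
      ((hu'.norm.pow 2).intervalIntegrable _ _)
  calc ‖u t - u a‖ ^ 2 ≤ (∫ s in a..t, ‖u' s‖) ^ 2 := by gcongr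
    _ ≤ (t - a) * ∫ s in a..t, ‖u' s‖ ^ 2 := sq_integral_le_mul_integral_sq hu'.norm ht.1
    _ ≤ (b - a) * ∫ s in a..b, ‖u' s‖ ^ 2 :=
      mul_le_mul (by linarith [ht.2]) h2
        (intervalIntegral.integral_nonneg ht.1 fun s _ => sq_nonneg _) (by linarith [ht.1, ht.2])

/-- The step function with value `v k` on `(p k, p (k + 1)]`. -/
def stepFun {F : Type*} [NormedAddCommGroup F] (p : ℕ → ℝ) (n : ℕ)
    (v : Fin n → F) (t : ℝ) : F :=
  ∑ k : Fin n, (Set.Ioc (p k) (p (k + 1))).indicator (fun _ => v k) t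

theorem memLp_stepFun {F : Type*} [NormedAddCommGroup F] (p : ℕ → ℝ) (n : ℕ)
    (v : Fin n → F) : MemLp (stepFun p n v) 2 (volume : Measure ℝ) :=
  memLp_finsetSum _ fun k _ => memLp_indicator_const 2 measurableSet_Ioc (v k)
    (Or.inr measure_Ioc_lt_top.ne)

/-- Step functions with respect to a fixed partition, as elements of `L²`. -/
def stepLp (Δ : Type*) [NormedAddCommGroup Δ] [InnerProductSpace ℂ Δ] (p : ℕ → ℝ) (n : ℕ) :
    (Fin n → Δ) →ₗ[ℂ] Lp Δ 2 (volume : Measure ℝ) where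
  toFun v := (memLp_stepFun p n v).toLp
  map_add' v w := by
    rw [← MemLp.toLp_add]
    congr 1
    funext t
    simp only [stepFun, Pi.add_apply, ← Finset.sum_add_distrib]
    exact Finset.sum_congr rfl fun k _ => congrFun (Set.indicator_add _ _ _) t
  map_smul' c v := by
    rw [RingHom.id_apply, ← MemLp.toLp_const_smul]
    congr 1
    funext t
    simp only [stepFun, Pi.smul_apply, Finset.smul_sum]
    exact Finset.sum_congr rfl fun k _ => congrFun (Set.indicator_const_smul _ _ _) t

theorem stepFun_eq_of_mem {F : Type*} [NormedAddCommGroup F] {p : ℕ → ℝ} (hp : Monotone p) {n : ℕ}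
    (v : Fin n → F) (k : Fin n)
    {t : ℝ} (ht : t ∈ Set.Ioc (p k) (p (k + 1))) : stepFun p n v t = v k := by
  rw [stepFun, Finset.sum_eq_single k, Set.indicator_of_mem ht]
  · intro j _ hjk
    refine Set.indicator_of_notMem (fun hj => ?_) _
    rcases lt_or_gt_of_ne (fun h => hjk (Fin.ext h) : (j : ℕ) ≠ k) with h | h
    · exact absurd (hj.2.trans (hp h)) (not_le.2 ht.1)
    · exact absurd (ht.2.trans (hp h)) (not_le.2 hj.1)
  · exact fun h => absurd (Finset.mem_univ k) h

theorem stepFun_eq_zero {F : Type*} [NormedAddCommGroup F] {p : ℕ → ℝ} (hp : Monotone p) {n : ℕ}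
    (v : Fin n → F)
    {t : ℝ} (ht : t ∉ Set.Ioc (p 0) (p n)) : stepFun p n v t = 0 :=
  Finset.sum_eq_zero fun k _ => Set.indicator_of_notMem
    (fun h => ht ⟨(hp (Nat.zero_le _)).trans_lt h.1, h.2.trans (hp k.2)⟩) _

/-- Sample `φ` at the left endpoints of `n` equal cells of `(-N, N]`. With mesh `h`, the squared
error on a cell is at most `h²` times the integral of `‖φ'‖²` there; outside, the error is `φ`
itself. The space depends only on `N` and `n`. -/
theorem exists_step_approx [CompleteSpace Δ] [FiniteDimensional ℂ Δ] {N : ℝ} (hN : 0 < N) {n : ℕ}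
    (hn : 0 < n) : ∃ (V : Submodule ℂ (Lp Δ 2 (volume : Measure ℝ))) (_ : FiniteDimensional ℂ V),
      ∀ φ : 𝓢(ℝ, Δ), ∃ s ∈ V, ‖schwartzToL2 Δ φ - s‖ ^ 2 ≤
        (2 * N / n) ^ 2 * (∫ t, ‖deriv φ t‖ ^ 2) + ∫ t in {t | N ≤ |t|}, ‖φ t‖ ^ 2 := by
  set h : ℝ := 2 * N / n with hh
  have hn' : (0 : ℝ) < n := by exact_mod_cast hn
  have hpos : 0 < h := by positivity
  set p : ℕ → ℝ := fun k => -N + k * h with hpdef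
  have hp : Monotone p := by
    intro i j hij
    simp only [hpdef]
    gcongr
  have hp0 : p 0 = -N := by simp [hpdef]
  have hpn : p n = N := by
    simp only [hpdef, hh]
    field_simp
    ring
  have hps : ∀ k, p (k + 1) - p k = h := fun k => by
    simp only [hpdef]
    push_cast
    ring
  refine ⟨LinearMap.range (stepLp Δ p n), inferInstance, fun φ => ?_⟩
  set v : Fin n → Δ := fun k => φ (p k) with hv
  refine ⟨stepLp Δ p n v, LinearMap.mem_range_self _ _, ?_⟩
  set e : ℝ → ℝ := fun t => ‖φ t - stepFun p n v t‖ ^ 2 with he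
  have hmem : MemLp (fun t => φ t - stepFun p n v t) 2 volume :=
    (φ.memLp 2).sub (memLp_stepFun p n v)
  have hei : Integrable e := hmem.integrable_norm_pow two_ne_zero
  have h1 : ‖schwartzToL2 Δ φ - stepLp Δ p n v‖ ^ 2 = ∫ t, e t := by
    rw [L2.norm_sq_eq_integral]
    refine integral_congr_ae ?_
    filter_upwards [Lp.coeFn_sub (schwartzToL2 Δ φ) (stepLp Δ p n v), φ.coeFn_toLp 2,
      (memLp_stepFun p n v).coeFn_toLp] with t h1 h2 h3
    rw [h1, Pi.sub_apply]
    exact congrArg₂ (fun x y => ‖x - y‖ ^ 2) h2 h3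
  have hφc : Continuous (deriv φ) := (derivCLM ℂ Δ φ).continuous
  have hφi : Integrable fun t => ‖deriv φ t‖ ^ 2 := (derivCLM ℂ Δ φ).integrable_norm_sq
  have hpiece : ∀ k < n, ∫ t in (p k)..(p (k + 1)), e t ≤
      ∫ t in (p k)..(p (k + 1)), h ^ 2 * ‖deriv φ t‖ ^ 2 := by
    intro k hk
    have hle : p k ≤ p (k + 1) := hp k.le_succ
    have hb : ∀ t ∈ Set.Ioc (p k) (p (k + 1)),
        e t ≤ h * ∫ s in (p k)..(p (k + 1)), ‖deriv φ s‖ ^ 2 := by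
      intro t ht
      simp only [he]
      rw [stepFun_eq_of_mem hp v ⟨k, hk⟩ ht, ← hps k]
      exact norm_sub_sq_le_mul_integral φ.hasDerivAt hφc ⟨ht.1.le, ht.2⟩
    rw [intervalIntegral.integral_of_le hle]
    calc _ ≤ ∫ t in Set.Ioc (p k) (p (k + 1)), h * ∫ s in (p k)..(p (k + 1)), ‖deriv φ s‖ ^ 2 :=
          setIntegral_mono_on hei.integrableOn (integrableOn_const measure_Ioc_lt_top.ne)
            measurableSet_Ioc hb
      _ = _ := by
          rw [← intervalIntegral.integral_of_le hle, intervalIntegral.integral_const, hps,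
            intervalIntegral.integral_const_mul, smul_eq_mul]
          ring
  have hin : ∫ t in Set.Ioc (-N) N, e t ≤ h ^ 2 * ∫ t, ‖deriv φ t‖ ^ 2 := by
    rw [← intervalIntegral.integral_of_le (by linarith), ← hp0, ← hpn,
      ← intervalIntegral.sum_integral_adjacent_intervals (a := p)
        fun k _ => hei.intervalIntegrable]
    calc _ ≤ ∑ k ∈ Finset.range n, ∫ t in (p k)..(p (k + 1)), h ^ 2 * ‖deriv φ t‖ ^ 2 :=
          Finset.sum_le_sum fun k hk => hpiece k (Finset.mem_range.1 hk)
      _ = ∫ t in (p 0)..(p n), h ^ 2 * ‖deriv φ t‖ ^ 2 :=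
          intervalIntegral.sum_integral_adjacent_intervals
            fun k _ => (hφi.const_mul _).intervalIntegrable
      _ ≤ _ := by
          rw [intervalIntegral.integral_const_mul, intervalIntegral.integral_of_le
            (hp (Nat.zero_le n))]
          exact mul_le_mul_of_nonneg_left (setIntegral_le_integral hφi
            (Filter.Eventually.of_forall fun t => sq_nonneg _)) (sq_nonneg h)
  have hS : MeasurableSet {t : ℝ | N ≤ |t|} := measurableSet_le measurable_const measurable_norm
  have hout : ∫ t in (Set.Ioc (-N) N)ᶜ, e t ≤ ∫ t in {t | N ≤ |t|}, ‖φ t‖ ^ 2 := by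
    calc _ = ∫ t in (Set.Ioc (-N) N)ᶜ, ‖φ t‖ ^ 2 :=
          setIntegral_congr_fun measurableSet_Ioc.compl fun t ht => by
            simp only [he]
            rw [stepFun_eq_zero hp v (by rwa [hp0, hpn]), sub_zero]
      _ ≤ _ := by
          refine setIntegral_mono_set φ.integrable_norm_sq.integrableOn
            (Filter.Eventually.of_forall fun t => sq_nonneg _)
            (Filter.Eventually.of_forall fun t ht => ?_)
          by_contra hlt
          have hlt' := abs_lt.1 (not_le.1 hlt)
          exact ht ⟨hlt'.1, hlt'.2.le⟩
  rw [h1, ← integral_add_compl measurableSet_Ioc hei]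
  exact add_le_add hin hout

end StepApproximation

/-! ### Assembly: approximation in graph norm and density of the range. -/

section Main

variable {H : Type*} [NormedAddCommGroup H] [InnerProductSpace ℝ H]
variable {Δ : Type*} [NormedAddCommGroup Δ] [InnerProductSpace ℂ Δ] [FiniteDimensional ℂ Δ]
  [CompleteSpace Δ]
variable {ρ : CliffordAlg H →ₐ[ℝ] Module.End ℂ Δ} {a : H} {Ω : ℝ → H}

theorem IsSkewCliffordModule.exists_approx_diracSchwartz [FiniteDimensional ℝ H]
    (hρ : IsSkewCliffordModule ρ)
    (ha : a ≠ 0) (hΩ : IsPolynomialFun Ω) (horth : ∀ t : ℝ, ⟪a, Ω t⟫_ℝ = 0)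
    (hne : ¬ ∃ c : H, ∀ t : ℝ, Ω t = c) {ε : ℝ} (hε : 0 < ε) :
    ∃ (V : Submodule ℂ (Lp Δ 2 (volume : Measure ℝ))) (_ : FiniteDimensional ℂ V),
      ∀ φ : 𝓢(ℝ, Δ), ‖schwartzToL2 Δ φ - V.starProjection (schwartzToL2 Δ φ)‖ ≤
        ε * (‖schwartzToL2 Δ φ‖ + ‖schwartzToL2 Δ (diracSchwartz ρ a hΩ φ)‖) := by
  obtain ⟨Ω', hΩ', hd⟩ := hΩ.exists_hasDerivAt
  obtain ⟨C, hC, hM⟩ := hΩ.exists_lower_bound hΩ' hd hne (norm_nonneg a)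
  have ha0 : 0 < ‖a‖ := norm_pos_iff.2 ha
  -- Chosen so that `δ (1 + C) = ε²`. With `M = δ⁻¹` and mesh at most `‖a‖ √δ`, the squared step
  -- error is at most `δ` times the left side of the energy estimate.
  set δ : ℝ := ε ^ 2 / (1 + C) with hδ
  have hδ0 : 0 < δ := by positivity
  obtain ⟨N, hN, hW⟩ := hM δ⁻¹
  obtain ⟨n, hn⟩ := exists_nat_gt (2 * N / (‖a‖ * √δ))
  have hn0 : (0 : ℝ) < n := lt_of_le_of_lt (by positivity) hn
  obtain ⟨V, hV, happ⟩ := exists_step_approx (Δ := Δ) hN (n := n) (by exact_mod_cast hn0)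
  refine ⟨V, hV, fun φ => ?_⟩
  obtain ⟨s, hs, hle⟩ := happ φ
  refine (V.norm_sub_starProjection_le _ hs).trans ?_
  have hE := hρ.energy_le hΩ hΩ' hd horth hW φ
  set X := ∫ t, ‖deriv φ t‖ ^ 2
  set Y := ∫ t in {t | N ≤ |t|}, ‖φ t‖ ^ 2
  have hX : 0 ≤ X := integral_nonneg fun t => sq_nonneg _
  set x := ‖schwartzToL2 Δ φ‖
  set y := ‖schwartzToL2 Δ (diracSchwartz ρ a hΩ φ)‖
  have hx : 0 ≤ x := norm_nonneg _
  have hy : 0 ≤ y := norm_nonneg _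
  have h1 : (2 * N / n) ^ 2 ≤ δ * ‖a‖ ^ 2 := by
    have h2 : 2 * N / n ≤ ‖a‖ * √δ := by
      rw [div_le_iff₀ hn0, ← div_le_iff₀' (by positivity)]
      exact hn.le
    calc (2 * N / n) ^ 2 ≤ (‖a‖ * √δ) ^ 2 := by gcongr
      _ = δ * ‖a‖ ^ 2 := by rw [mul_pow, Real.sq_sqrt hδ0.le, mul_comm]
  refine (sq_le_sq₀ (norm_nonneg _) (by positivity)).1 (hle.trans ?_)
  calc (2 * N / n) ^ 2 * X + Y ≤ δ * ‖a‖ ^ 2 * X + Y := by gcongr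
    _ = δ * (‖a‖ ^ 2 * X + δ⁻¹ * Y) := by field_simp
    _ ≤ δ * (y ^ 2 + C * x ^ 2) := by gcongr
    _ ≤ δ * ((1 + C) * (x + y) ^ 2) := by
        gcongr
        nlinarith [mul_nonneg hx hy, mul_nonneg hC (mul_nonneg hx hy), mul_nonneg hC (sq_nonneg y),
          sq_nonneg x]
    _ = (ε * (x + y)) ^ 2 := by rw [hδ]; field_simp

/-- The image of the Schwartz functions alone is dense, its orthogonal complement being zero by the
deficiency argument. -/
theorem IsSkewCliffordModule.dense_range_diracOp_closure_sub (hρ : IsSkewCliffordModule ρ)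
    (ha : a ≠ 0) (hΩ : IsPolynomialFun Ω) {z : ℂ} (hz : z.im ≠ 0) :
    Dense (Set.range fun x : (diracOp ρ a hΩ).closure.domain =>
      (diracOp ρ a hΩ).closure x - z • (x : Lp Δ 2 (volume : Measure ℝ))) := by
  set T := diracOp ρ a hΩ with hT
  let D : 𝓢(ℝ, Δ) →ₗ[ℂ] Lp Δ 2 (volume : Measure ℝ) :=
    schwartzToL2 Δ ∘ₗ (diracSchwartz ρ a hΩ).toLinearMap - z • schwartzToL2 Δ
  have hD : ∀ φ, D φ = schwartzToL2 Δ (diracSchwartz ρ a hΩ φ) - z • schwartzToL2 Δ φ :=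
    fun φ => rfl
  have hdense : Dense (LinearMap.range D : Set (Lp Δ 2 (volume : Measure ℝ))) := by
    rw [Submodule.dense_iff_topologicalClosure_eq_top,
      Submodule.topologicalClosure_eq_top_iff, Submodule.eq_bot_iff]
    intro y hy
    refine hρ.eq_zero_of_inner_diracSchwartz_eq_zero ha hΩ hz fun φ => ?_
    rw [← hD]
    exact (Submodule.mem_orthogonal _ _).1 hy _ (LinearMap.mem_range_self _ _)
  refine hdense.mono ?_
  rintro _ ⟨φ, rfl⟩
  have hle := T.le_closure
  have hmem : schwartzToL2 Δ φ ∈ T.domain := LinearMap.mem_range_self _ φ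
  refine ⟨⟨schwartzToL2 Δ φ, hle.1 hmem⟩, ?_⟩
  simp only
  rw [← hle.2 (x := ⟨_, hmem⟩) rfl, hD]
  congr 1
  exact diracOp_apply ρ a hΩ φ

end Main

end

theorem mainTheorem4 {H : Type*} [NormedAddCommGroup H] [InnerProductSpace ℝ H]
    [FiniteDimensional ℝ H]
    {Δ : Type*} [NormedAddCommGroup Δ] [InnerProductSpace ℂ Δ] [FiniteDimensional ℂ Δ]
    [CompleteSpace Δ]
    (ρ : CliffordAlg H →ₐ[ℝ] Module.End ℂ Δ) (hρ : IsSkewCliffordModule ρ)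
    (a : H) (ha : a ≠ 0)
    (Ω : ℝ → H) (hΩ : IsPolynomialFun Ω) (hΩ_orth : ∀ t : ℝ, ⟪a, Ω t⟫_ℝ = 0)
    (hΩ_nonconst : ¬ ∃ c : H, ∀ t : ℝ, Ω t = c) :
    IsEssentiallySelfAdjoint (diracOp ρ a hΩ) ∧
      HasDiscreteSpectrum (diracOp ρ a hΩ).closure ∧
      HasCompactResolvent (diracOp ρ a hΩ).closure := by
  have hdense := dense_diracOp_domain ρ a hΩ
  have hsymm := hρ.isFormalAdjoint_diracOp a hΩ
  have hcl := hsymm.isClosable hdense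
  have hsymm' := hsymm.closure hcl
  have hres : ∀ z : ℂ, z.im ≠ 0 → ∃ R : Lp Δ 2 (volume : Measure ℝ) →L[ℂ] Lp Δ 2 volume,
      IsResolventAt (diracOp ρ a hΩ).closure z R := fun z hz =>
    hsymm'.exists_isResolventAt hcl.closure_isClosed hz
      (hρ.dense_range_diracOp_closure_sub ha hΩ hz)
  have happrox : ∀ ε : ℝ, 0 < ε → ∃ (V : Submodule ℂ (Lp Δ 2 (volume : Measure ℝ)))
      (_ : FiniteDimensional ℂ V), ∀ x : (diracOp ρ a hΩ).closure.domain,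
        ‖(x : Lp Δ 2 (volume : Measure ℝ)) - V.starProjection x‖ ≤
          ε * (‖(x : Lp Δ 2 (volume : Measure ℝ))‖ + ‖(diracOp ρ a hΩ).closure x‖) := by
    intro ε hε
    obtain ⟨V, hV, h⟩ := hρ.exists_approx_diracSchwartz ha hΩ hΩ_orth hΩ_nonconst hε
    refine ⟨V, hV, hcl.closure_induction
      (p := fun q => ‖q.1 - V.starProjection q.1‖ ≤ ε * (‖q.1‖ + ‖q.2‖))
      (isClosed_le (by fun_prop) (by fun_prop)) ?_⟩
    rintro ⟨_, φ, rfl⟩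
    simp only
    rw [diracOp_apply]
    exact h φ
  obtain ⟨R, hR⟩ := hres Complex.I (by simp)
  obtain ⟨R', hR'⟩ := hres (starRingEnd ℂ Complex.I) (by simp)
  refine ⟨⟨hdense, hsymm, hcl, hsymm'.isSelfAdjoint
    (hdense.mono (diracOp ρ a hΩ).le_closure.1) hR hR'⟩,
    HasDiscreteSpectrum.of_isCompactOperator hsymm' hR (hR.isCompactOperator happrox),
    ⟨Complex.I, R, hR⟩, fun z S hS => hS.isCompactOperator happrox⟩
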